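/- **Conventions.** All operations have arity $n\ge 1$. A *minion* $\mathcal M$ consists of nonempty sets $\mathcal M^{(n)}$ $(n\ge 1)$ and maps $\mathcal M^{(\alpha)}:\mathcal M^{(n)}\to\mathcal M^{(m)}$ for all $\alpha:[n]\to[m]$ with $\mathcal M^{(\mathrm{id})}=\mathrm{id}$ and $\mathcal M^{(\alpha)}\circ\mathcal M^{(\beta)}=\mathcal M^{(\alpha\circ\beta)}$. A *homomorphism* $\xi:\mathcal M\to\mathcal N$ is a family of maps $\xi^{(n)}:\mathcal M^{(n)}\to\mathcal N^{(n)}$ with $\xi^{(m)}(\mathcal M^{(\alpha)}(f))=\mathcal N^{(\alpha)}(\xi^{(n)}(f))$. Minions $\mathcal M,\mathcal N$ are *equivalent* if there are homomorphisms $\mathcal M\to\mathcal N$ and $\mathcal N\to\mathcal M$. A *minion core* is a minion all of whose endomorphisms are automorphisms. A set of ($k$-tuples of) operations closed under the minors $f^{(\alpha)}(a_1,\dots,a_m)=f(a_{\alpha(1)},\dots,a_{\alpha(n)})$ (taken componentwise), with at least one member, is regarded as a minion. For a set $\Psi$ of relations of positive arity on a set $A$, $\mathrm{Pol}(\Psi)$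 is the minion of all operations on $A$ that preserve every relation in $\Psi$. A relation has *small projections* if its projection onto every coordinate has at most two elements. For Boolean operations $f,g:\{0,1\}^n\to\{0,1\}$ write $f\le g$ for the pointwise order, $f\triangleleft g$ if $f(\mathbf a)\le g(\mathbf b)$ whenever $\mathbf a\le\mathbf b$ coordinatewise, and $f^d(\mathbf a)=1-f(\overline{\mathbf a})$, where $\overline{\mathbf a}=(1-a_1,\dots,1-a_n)$. Let $\mathcal I_k$ be the set of all $k$-tuples $(h_1,\dots,h_k)$ of idempotent Boolean operations of the same arity. Let $\mathcal T$ be the clone of all operations on a one-element set, and let $$\begin{aligned} \mathcal A_k&=\{\mathbf h\in\mathcal I_k: h_1\triangleleft h_2\triangleleft\dots\triangleleft h_k\le h_k^d\}&(k\ge1),\\ \mathcal B_k&=\{\mathbf h\in\mathcal I_k: h_1\triangleleft h_2\triangleleft\dots\triangleleft h_k\triangleleft h_k^d\}&(k\ge1),\\ \mathcal C_k&=\{\mathbf h\in\mathcal I_k: h_1\triangleleft\dots\triangleleft h_{k-1}\le h_k=h_k^d,\ h_{k-1}\triangleleft h_{k-1}^d\}&(k\ge2),\\ \mathcal D_k&=\{\mathbf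 h\in\mathcal I_k: h_1\triangleleft h_2\triangleleft\dots\triangleleft h_k=h_k^d\}&(k\ge1),\\ \mathcal B_\infty&=\{(h)\in\mathcal I_1: h\triangleleft h\triangleleft h^d\},\\ \mathcal C_\infty&=\{(h_1,h_2)\in\mathcal I_2: h_1\triangleleft h_1\triangleleft h_2=h_2^d\},\\ \mathcal D_\infty&=\{(h)\in\mathcal I_1: h\triangleleft h=h^d\}. \end{aligned}$$ **Theorem.** Each of the minions $\mathcal T$, $\mathcal A_k$, $\mathcal B_k$, $\mathcal D_k$ $(k\ge1)$, $\mathcal C_k$ $(k\ge2)$, $\mathcal B_\infty$, $\mathcal C_\infty$, $\mathcal D_\infty$ is a minion core. If $\Psi$ is a set of at most binary relations with small projections on a finite set, then $\mathrm{Pol}(\Psi)$ is equivalent to exactly one of these minions. Conversely, for every minion $\mathcal M$ in this list there is a set $\Psi$ of at most binary relations with small projections on a finite set such that $\mathrm{Pol}(\Psi)$ is equivalent to $\mathcal M$. -/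

import Mathlib

universe u v w

/-! ### Abstract minions and their homomorphisms -/

/-- An (abstract) minion: nonempty sets `M n` for every arity `n ≥ 1`, with functorial minor maps
`M n → M m` for all functions `α : [n] → [m]`. -/
structure Minion where
  carrier : ℕ+ → Type u
  nonempty : ∀ n, Nonempty (carrier n)
  minor : ∀ {n m : ℕ+}, (Fin n → Fin m) → carrier n → carrier m
  minor_id : ∀ {n : ℕ+} (f : carrier n), minor (fun i : Fin n => i) f = f
  minor_comp : ∀ {n m l : ℕ+} (α : Fin m → Fin l) (β : Fin n → Fin m) (f : carrier n),
    minor α (minor β f) = minor (fun i => α (β i)) f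

/-- A minion homomorphism: an arity-wise map which preserves taking minors. -/
@[ext]
structure MinionHom (M : Minion.{u}) (N : Minion.{v}) where
  toFun : ∀ n : ℕ+, M.carrier n → N.carrier n
  map_minor : ∀ {n m : ℕ+} (α : Fin n → Fin m) (f : M.carrier n),
    toFun m (M.minor α f) = N.minor α (toFun n f)

/-- The identity homomorphism. -/
def MinionHom.id (M : Minion.{u}) : MinionHom M M where
  toFun := fun _ f => f
  map_minor := fun _ _ => rfl

/-- Composition of homomorphisms (`ν` after `ξ`). -/
def MinionHom.comp {M : Minion.{u}} {N : Minion.{v}} {K : Minion.{w}}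
    (ν : MinionHom N K) (ξ : MinionHom M N) : MinionHom M K where
  toFun := fun n f => ν.toFun n (ξ.toFun n f)
  map_minor := fun α f => by rw [ξ.map_minor, ν.map_minor]

/-- `M ≤ N`: there is a minion homomorphism from `M` to `N`. -/
def Minion.HomLE (M : Minion.{u}) (N : Minion.{v}) : Prop := Nonempty (MinionHom M N)

/-- `M ∼ N`: there are minion homomorphisms in both directions. -/
def Minion.Equivalent (M : Minion.{u}) (N : Minion.{v}) : Prop := M.HomLE N ∧ N.HomLE M

/-- A minion core: every endomorphism is an automorphism. -/
def Minion.IsCore (M : Minion.{u}) : Prop :=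
  ∀ ξ : MinionHom M M, ∃ ν : MinionHom M M,
    ν.comp ξ = MinionHom.id M ∧ ξ.comp ν = MinionHom.id M

/-! ### Operations and polymorphisms -/

/-- `n`-ary operations on `A`. -/
abbrev Operation (A : Type u) (n : ℕ+) : Type u := (Fin n → A) → A

/-- The minor `f^(α)`, that is, `f^(α)(a₁, …, aₘ) = f(a_{α(1)}, …, a_{α(n)})`. -/
def Operation.minor {A : Type u} {n m : ℕ+} (α : Fin n → Fin m) (f : Operation A n) :
    Operation A m := fun a => f (fun i => a (α i))

/-- The projection to the `i`-th coordinate. -/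
def Operation.proj (A : Type u) {n : ℕ+} (i : Fin n) : Operation A n := fun a => a i

/-- A relation on `A` together with its (positive) arity. -/
structure FinitaryRel (A : Type u) where
  arity : ℕ+
  tuples : Set (Fin arity → A)

/-- The projection of `R` onto every coordinate has at most two elements. -/
def FinitaryRel.HasSmallProjections {A : Type u} (R : FinitaryRel A) : Prop :=
  ∀ j : Fin R.arity, ((fun t : Fin R.arity → A => t j) '' R.tuples).encard ≤ 2

/-- `f` applied component-wise to tuples in `R` results in a tuple in `R`. -/
def Operation.Preserves {A : Type u} {n : ℕ+} (f : Operation A n) (R : FinitaryRel A) : Prop :=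
  ∀ r : Fin n → (Fin R.arity → A), (∀ i, r i ∈ R.tuples) → (fun j => f (fun i => r i j)) ∈ R.tuples

/-- `Pol(Ψ)`, as a minion: the operations preserving all relations in `Ψ`. -/
def Pol {A : Type u} (Ψ : Set (FinitaryRel A)) : Minion.{u} where
  carrier := fun n => {f : Operation A n // ∀ R ∈ Ψ, f.Preserves R}
  nonempty := fun n => ⟨⟨Operation.proj A ⟨0, n.pos⟩, fun _ _ _ hr => hr _⟩⟩
  minor := fun α f => ⟨f.1.minor α, fun R hR r hr => f.2 R hR (fun i => r (α i)) fun i => hr (α i)⟩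
  minor_id := fun _ => rfl
  minor_comp := fun _ _ _ => rfl

/-- The clone (of all operations) on a one-element set. -/
def minionT : Minion.{0} where
  carrier := fun n => Operation Unit n
  nonempty := fun _ => ⟨fun _ => ()⟩
  minor := fun α f => f.minor α
  minor_id := fun _ => rfl
  minor_comp := fun _ _ _ => rfl

/-! ### Boolean operations; `Bool` plays the role of `{0,1}`, with `false < true` -/

/-- `f` is idempotent. -/
def Operation.IsIdempotent {A : Type u} {n : ℕ+} (f : Operation A n) : Prop :=
  ∀ a : A, f (fun _ => a) = a

/-- `f ◁ g`: `f a ≤ g b` whenever `a ≤ b` coordinatewise. -/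
def Operation.Tri {n : ℕ+} (f g : Operation Bool n) : Prop :=
  ∀ a b : Fin n → Bool, a ≤ b → f a ≤ g b

/-- The dual `f^d(a) = 1 - f(1 - a)`. -/
def Operation.dual {n : ℕ+} (f : Operation Bool n) : Operation Bool n :=
  fun a => !(f fun i => !(a i))

theorem Operation.Tri.minor {n m : ℕ+} {f g : Operation Bool n} (h : f.Tri g)
    (α : Fin n → Fin m) : Operation.Tri (Operation.minor α f) (Operation.minor α g) :=
  fun _ _ hab => h _ _ fun i => hab (α i)

theorem Operation.le_minor {n m : ℕ+} {f g : Operation Bool n} (h : f ≤ g)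
    (α : Fin n → Fin m) : Operation.minor α f ≤ Operation.minor α g :=
  fun _ => h _

theorem Operation.dual_minor {n m : ℕ+} (f : Operation Bool n) (α : Fin n → Fin m) :
    (Operation.minor α f).dual = Operation.minor α f.dual := rfl

theorem Operation.proj_tri {n : ℕ+} (i : Fin n) :
    (Operation.proj Bool i).Tri (Operation.proj Bool i) := fun _ _ hab => hab i

theorem Operation.dual_proj {n : ℕ+} (i : Fin n) :
    (Operation.proj Bool i).dual = Operation.proj Bool i := by
  funext a
  simp [Operation.dual, Operation.proj]

/-! ### Multisorted Boolean minions -/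

/-- `n`-ary `k`-sorted Boolean operations, i.e. `k`-tuples of `n`-ary Boolean operations. The sort
number `i + 1` (in `1, …, k`) is represented by `i : Fin k`. -/
abbrev SortedBoolOp (k : ℕ) (n : ℕ+) : Type := Fin k → Operation Bool n

/-- The minion of all idempotent `k`-sorted Boolean operations that satisfy `P`, for a condition
`P` stable under minors and satisfied by the projections. -/
def boolMinion (k : ℕ) (P : ∀ n : ℕ+, SortedBoolOp k n → Prop)
    (hproj : ∀ (n : ℕ+) (i : Fin n), P n (fun _ => Operation.proj Bool i))
    (hminor : ∀ (n m : ℕ+) (α : Fin n → Fin m) (h : SortedBoolOp k n), P n h →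
      P m (fun s => (h s).minor α)) : Minion.{0} where
  carrier := fun n => {h : SortedBoolOp k n // (∀ s, (h s).IsIdempotent) ∧ P n h}
  nonempty := fun n =>
    ⟨⟨fun _ => Operation.proj Bool ⟨0, n.pos⟩, fun _ _ => rfl, hproj n _⟩⟩
  minor := fun {n m} α h =>
    ⟨fun s => (h.1 s).minor α, fun s a => h.2.1 s a, hminor n m α h.1 h.2.2⟩
  minor_id := fun _ => rfl
  minor_comp := fun _ _ _ => rfl

/-- `h₁ ◁ h₂ ◁ ⋯ ◁ hₖ ≤ hₖ^d`. -/
def CondA (k : ℕ) (n : ℕ+) (h : SortedBoolOp k n) : Prop :=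
  (∀ i j : Fin k, (i : ℕ) + 1 = j → (h i).Tri (h j)) ∧
  (∀ i : Fin k, (i : ℕ) + 1 = k → h i ≤ (h i).dual)

/-- `h₁ ◁ h₂ ◁ ⋯ ◁ hₖ ◁ hₖ^d`. -/
def CondB (k : ℕ) (n : ℕ+) (h : SortedBoolOp k n) : Prop :=
  (∀ i j : Fin k, (i : ℕ) + 1 = j → (h i).Tri (h j)) ∧
  (∀ i : Fin k, (i : ℕ) + 1 = k → (h i).Tri (h i).dual)

/-- `h₁ ◁ h₂ ◁ ⋯ ◁ hₖ₋₁ ≤ hₖ = hₖ^d` and `hₖ₋₁ ◁ hₖ₋₁^d`. -/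
def CondC (k : ℕ) (n : ℕ+) (h : SortedBoolOp k n) : Prop :=
  (∀ i j : Fin k, (i : ℕ) + 1 = j → (j : ℕ) + 1 < k → (h i).Tri (h j)) ∧
  (∀ i j : Fin k, (i : ℕ) + 1 = j → (j : ℕ) + 1 = k → h i ≤ h j) ∧
  (∀ j : Fin k, (j : ℕ) + 1 = k → h j = (h j).dual) ∧
  (∀ i : Fin k, (i : ℕ) + 2 = k → (h i).Tri (h i).dual)

/-- `h₁ ◁ h₂ ◁ ⋯ ◁ hₖ = hₖ^d`. -/
def CondD (k : ℕ) (n : ℕ+) (h : SortedBoolOp k n) : Prop :=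
  (∀ i j : Fin k, (i : ℕ) + 1 = j → (h i).Tri (h j)) ∧
  (∀ i : Fin k, (i : ℕ) + 1 = k → h i = (h i).dual)

/-- `h ◁ h ◁ h^d`. -/
def CondBInf (n : ℕ+) (h : SortedBoolOp 1 n) : Prop :=
  (h 0).Tri (h 0) ∧ (h 0).Tri (h 0).dual

/-- `h₁ ◁ h₁ ◁ h₂ = h₂^d`. -/
def CondCInf (n : ℕ+) (h : SortedBoolOp 2 n) : Prop :=
  (h 0).Tri (h 0) ∧ (h 0).Tri (h 1) ∧ h 1 = (h 1).dual

/-- `h ◁ h = h^d`. -/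
def CondDInf (n : ℕ+) (h : SortedBoolOp 1 n) : Prop :=
  (h 0).Tri (h 0) ∧ h 0 = (h 0).dual

def minionA (k : ℕ) : Minion.{0} := boolMinion k (CondA k)
  (fun _ i => ⟨fun _ _ _ => Operation.proj_tri i, fun _ _ => (Operation.dual_proj i).ge⟩)
  (fun _ _ α _ hh => ⟨fun i j hij => (hh.1 i j hij).minor α,
    fun i hi => Operation.le_minor (hh.2 i hi) α⟩)

def minionB (k : ℕ) : Minion.{0} := boolMinion k (CondB k)
  (fun _ i => ⟨fun _ _ _ => Operation.proj_tri i,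
    fun _ _ => by rw [Operation.dual_proj]; exact Operation.proj_tri i⟩)
  (fun _ _ α _ hh => ⟨fun i j hij => (hh.1 i j hij).minor α, fun i hi => (hh.2 i hi).minor α⟩)

def minionC (k : ℕ) : Minion.{0} := boolMinion k (CondC k)
  (fun _ i => ⟨fun _ _ _ _ => Operation.proj_tri i, fun _ _ _ _ => le_refl _,
    fun _ _ => (Operation.dual_proj i).symm,
    fun _ _ => by rw [Operation.dual_proj]; exact Operation.proj_tri i⟩)
  (fun _ _ α _ hh => ⟨fun i j hij hj => (hh.1 i j hij hj).minor α,
    fun i j hij hj => Operation.le_minor (hh.2.1 i j hij hj) α,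
    fun j hj => congrArg (Operation.minor α) (hh.2.2.1 j hj),
    fun i hi => (hh.2.2.2 i hi).minor α⟩)

def minionD (k : ℕ) : Minion.{0} := boolMinion k (CondD k)
  (fun _ i => ⟨fun _ _ _ => Operation.proj_tri i, fun _ _ => (Operation.dual_proj i).symm⟩)
  (fun _ _ α _ hh => ⟨fun i j hij => (hh.1 i j hij).minor α,
    fun i hi => congrArg (Operation.minor α) (hh.2 i hi)⟩)

def minionBInf : Minion.{0} := boolMinion 1 CondBInf
  (fun _ i => ⟨Operation.proj_tri i, by rw [Operation.dual_proj]; exact Operation.proj_tri i⟩)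
  (fun _ _ α _ hh => ⟨hh.1.minor α, hh.2.minor α⟩)

def minionCInf : Minion.{0} := boolMinion 2 CondCInf
  (fun _ i => ⟨Operation.proj_tri i, Operation.proj_tri i, (Operation.dual_proj i).symm⟩)
  (fun _ _ α _ hh => ⟨hh.1.minor α, hh.2.1.minor α, congrArg (Operation.minor α) hh.2.2⟩)

def minionDInf : Minion.{0} := boolMinion 1 CondDInf
  (fun _ i => ⟨Operation.proj_tri i, (Operation.dual_proj i).symm⟩)
  (fun _ _ α _ hh => ⟨hh.1.minor α, congrArg (Operation.minor α) hh.2⟩)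

/-- The names in the list `T`, `A_k`, `B_k`, `D_k` (`k ≥ 1`), `C_k` (`k ≥ 2`), `B_∞`, `C_∞`,
`D_∞`. -/
inductive CoreName : Type where
  | T : CoreName
  | A (k : ℕ) (hk : 1 ≤ k) : CoreName
  | B (k : ℕ) (hk : 1 ≤ k) : CoreName
  | C (k : ℕ) (hk : 2 ≤ k) : CoreName
  | D (k : ℕ) (hk : 1 ≤ k) : CoreName
  | BInf : CoreName
  | CInf : CoreName
  | DInf : CoreName

/-- The minion with a given name. -/
def CoreName.minion : CoreName → Minion.{0}
  | .T => minionT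
  | .A k _ => minionA k
  | .B k _ => minionB k
  | .C k _ => minionC k
  | .D k _ => minionD k
  | .BInf => minionBInf
  | .CInf => minionCInf
  | .DInf => minionDInf

/-! Every listed minion other than the trivial one encodes chains $h_1\le\dots\le h_k\le
h_k^d\le\dots\le h_1^d$. Let $v(\mathbf a)$ be the number of members of the chain that are true at
$\mathbf a$, with $h_k$ and $h_k^d$ counted once if they are required to coincide. Then $v(\mathbf
a)+v(\overline{\mathbf a})=m$ with $m=2k$ or $m=2k-1$, and the conditions $\triangleleft$ say which
pairs of levels may occur at $\mathbf a\le\mathbf b$. Since $v(\mathbf a)$ can be read off a binary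
minor, homomorphisms between such minions are maps of levels (`exists_levelMap`). Cores
(`levelHom_involutive`) and inequivalence (`CoreName.eq_of_homLE`) thus become statements about maps
between finite chains.

To classify $\mathrm{Pol}(\Psi)$, pass to idempotent polymorphisms (`exists_idempotent_reduct`). If
more than one element remains, each pair $x\ne y$ gives a minor-preserving map to Boolean
operations, oriented so that exchanging $x$ and $y$ is duality. Binary relations with small
projections impose only $\triangleleft$ or equality between these functionals. The resulting finite
set $V$ with $\triangleleft$ and duality decides the answer (`BoolFunctional.exists_grading`):
$F\triangleleft F^d\triangleleft F$ gives $\mathcal D_\infty$; otherwise a loop $F\triangleleft F$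
gives $\mathcal B_\infty$ or $\mathcal C_\infty$, and without loops the length $N$ of a longest walk
gives $k$, its parity separating $\mathcal A$ from $\mathcal B$ and $\mathcal D$ from $\mathcal C$.
A self-dual member of $V$ selects $\mathcal C$ or $\mathcal D$.

Both homomorphisms come from the same data. A walk met with its reversed dual is a chain below its
duals, which maps $\mathrm{Pol}(\Psi)$ to the listed minion. Conversely, heights in $V$ provide
thresholds $\tau$: a level map $v$ becomes the polymorphism that on a tuple over $\{x,y\}$ answers
$y$ exactly when the level of the set of positions of $y$ reaches $\tau(x,y)$
(`thresholdValue_preserves`). The listed minions are realized by several Boolean sorts joined by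
implications, with at most one sort carrying disequality. -/

/-! ### Level minions -/

/-- A relation `rel` on the chain of levels `0, …, top`, symmetric under the reversal of levels. -/
structure LevelStructure where
  top : ℕ
  rel : ℕ → ℕ → Prop
  rel_refl : ∀ i ≤ top, rel i i
  rel_zero : ∀ i ≤ top, rel 0 i
  rel_top : ∀ i ≤ top, rel i top
  rel_symm : ∀ i ≤ top, ∀ j ≤ top, rel i j → rel (top - j) (top - i)

/-- `v` assigns levels to Boolean tuples, compatibly with complementation and the order. -/
def LevelStructure.IsLevelMap (L : LevelStructure) {n : ℕ+} (v : (Fin n → Bool) → ℕ) : Prop :=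
  v (fun _ => false) = 0 ∧ (∀ a, v a + v (fun i => !(a i)) = L.top) ∧
    ∀ a b, a ≤ b → L.rel (v a) (v b)

theorem LevelStructure.IsLevelMap.le_top {L : LevelStructure} {n : ℕ+}
    {v : (Fin n → Bool) → ℕ} (hv : L.IsLevelMap v) (a : Fin n → Bool) : v a ≤ L.top :=
  (hv.2.1 a) ▸ Nat.le_add_right _ _

theorem LevelStructure.IsLevelMap.map_true {L : LevelStructure} {n : ℕ+}
    {v : (Fin n → Bool) → ℕ} (hv : L.IsLevelMap v) : v (fun _ => true) = L.top := by
  have h := hv.2.1 (fun _ => false)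
  rw [hv.1, zero_add] at h
  exact h

theorem LevelStructure.IsLevelMap.minor {L : LevelStructure} {n m : ℕ+}
    {v : (Fin n → Bool) → ℕ} (hv : L.IsLevelMap v) (α : Fin n → Fin m) :
    L.IsLevelMap (fun a : Fin m → Bool => v (fun i => a (α i))) :=
  ⟨hv.1, fun a => hv.2.1 fun i => a (α i), fun _ _ hab => hv.2.2 _ _ fun i => hab (α i)⟩

theorem LevelStructure.isLevelMap_proj (L : LevelStructure) {n : ℕ+} (i : Fin n) :
    L.IsLevelMap (fun a : Fin n → Bool => if a i then L.top else 0) := by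
  refine ⟨by simp, fun a => ?_, fun a b hab => ?_⟩
  · dsimp only
    rcases Bool.eq_false_or_eq_true (a i) with h | h <;> simp [h]
  have h := hab i
  revert h
  dsimp only
  cases a i <;> cases b i <;> intro h
  · exact L.rel_refl 0 (Nat.zero_le _)
  · exact L.rel_zero _ le_rfl
  · exact absurd h (by simp)
  · exact L.rel_refl _ le_rfl

/-- The minion of level maps. -/
def LevelStructure.minion (L : LevelStructure) : Minion.{0} where
  carrier := fun n => {v : (Fin n → Bool) → ℕ // L.IsLevelMap v}
  nonempty := fun n => ⟨⟨_, L.isLevelMap_proj ⟨0, n.pos⟩⟩⟩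
  minor := fun α v => ⟨fun a => v.1 (fun i => a (α i)), v.2.minor α⟩
  minor_id := fun _ => rfl
  minor_comp := fun _ _ _ => rfl

/-- Binary level map with value `i` at `(0, 1)`. -/
def pairLevel (m i : ℕ) : Bool → Bool → ℕ
  | false, false => 0
  | false, true => i
  | true, false => m - i
  | true, true => m

/-- Ternary level map with values `i` and `j` at `(1, 0, 0)` and `(1, 1, 0)`. -/
def tripleLevel (m i j : ℕ) : Bool → Bool → Bool → ℕ
  | false, false, false => 0
  | true, false, false => i
  | true, true, false => j
  | false, true, false => 0
  | true, true, true => m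
  | false, true, true => m - i
  | false, false, true => m - j
  | true, false, true => m

theorem LevelStructure.isLevelMap_pair (L : LevelStructure) {i : ℕ} (hi : i ≤ L.top) :
    L.IsLevelMap (n := ⟨2, two_pos⟩)
      (fun a => pairLevel L.top i (a ⟨0, by simp⟩) (a ⟨1, by simp⟩)) := by
  refine ⟨rfl, fun a => ?_, fun a b hab => ?_⟩
  · dsimp only
    cases a ⟨0, by simp⟩ <;> cases a ⟨1, by simp⟩ <;> simp [pairLevel, hi]
  · have h0 := hab ⟨0, by simp⟩
    have h1 := hab ⟨1, by simp⟩
    revert h0 h1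
    dsimp only
    have hmi : L.top - i ≤ L.top := Nat.sub_le _ _
    cases a ⟨0, by simp⟩ <;> cases a ⟨1, by simp⟩ <;> cases b ⟨0, by simp⟩ <;>
      cases b ⟨1, by simp⟩ <;> intro h0 h1 <;>
      first
        | exact absurd h0 (by decide)
        | exact absurd h1 (by decide)
        | exact L.rel_refl _ (by simp [pairLevel, hi])
        | exact L.rel_zero _ (by simp [pairLevel, hi])
        | exact L.rel_top _ (by simp [pairLevel, hi])

/-- Apart from reflexive comparisons and those with level 0 or `top`, the only ones are $i$ with $j$
and, by complementation, $m-j$ with $m-i$. So every related pair of levels occurs at comparable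
tuples, and homomorphisms must preserve it. -/
theorem LevelStructure.isLevelMap_triple (L : LevelStructure) {i j : ℕ} (hi : i ≤ L.top)
    (hj : j ≤ L.top) (hij : L.rel i j) :
    L.IsLevelMap (n := ⟨3, three_pos⟩)
      (fun a => tripleLevel L.top i j (a ⟨0, by simp⟩) (a ⟨1, by simp⟩) (a ⟨2, by simp⟩)) := by
  refine ⟨rfl, fun a => ?_, fun a b hab => ?_⟩
  · dsimp only
    cases a ⟨0, by simp⟩ <;> cases a ⟨1, by simp⟩ <;> cases a ⟨2, by simp⟩ <;>
      simp [tripleLevel, hi, hj]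
  · have h0 := hab ⟨0, by simp⟩
    have h1 := hab ⟨1, by simp⟩
    have h2 := hab ⟨2, by simp⟩
    revert h0 h1 h2
    dsimp only
    cases a ⟨0, by simp⟩ <;> cases a ⟨1, by simp⟩ <;> cases a ⟨2, by simp⟩ <;>
      cases b ⟨0, by simp⟩ <;> cases b ⟨1, by simp⟩ <;> cases b ⟨2, by simp⟩ <;>
      intro h0 h1 h2 <;>
      first
        | exact absurd h0 (by decide)
        | exact absurd h1 (by decide)
        | exact absurd h2 (by decide)
        | exact L.rel_refl _ (by simp [tripleLevel, hi, hj])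
        | exact L.rel_zero _ (by simp [tripleLevel, hi, hj])
        | exact L.rel_top _ (by simp [tripleLevel, hi, hj])
        | exact hij
        | exact L.rel_symm _ hi _ hj hij

/-- Homomorphisms of level minions act by a map on levels. -/
theorem LevelStructure.exists_levelMap {L L' : LevelStructure}
    (ξ : MinionHom L.minion L'.minion) :
    ∃ φ : ℕ → ℕ, (∀ (n : ℕ+) (v : L.minion.carrier n) (a : Fin n → Bool),
        (ξ.toFun n v).1 a = φ (v.1 a)) ∧ φ 0 = 0 ∧
      (∀ i ≤ L.top, φ i + φ (L.top - i) = L'.top) ∧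
      ∀ i ≤ L.top, ∀ j ≤ L.top, L.rel i j → L'.rel (φ i) (φ j) := by
  classical
  let e : ∀ i, i ≤ L.top → L.minion.carrier ⟨2, two_pos⟩ :=
    fun i hi => ⟨_, L.isLevelMap_pair hi⟩
  let φ : ℕ → ℕ := fun i => if hi : i ≤ L.top then
    (ξ.toFun ⟨2, two_pos⟩ (e i hi)).1 (fun t => decide (t.val = 1)) else 0
  have key : ∀ (n : ℕ+) (v : L.minion.carrier n) (a : Fin n → Bool),
      (ξ.toFun n v).1 a = φ (v.1 a) := by
    intro n v a
    have hle := v.2.le_top a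
    -- Identifying variables according to the bits of `a` leaves a binary level map. It is fixed by
    -- its value `v a` at $(0,1)$, so the image of `v` at `a` depends on `v a` alone.
    let α : Fin n → Fin (⟨2, two_pos⟩ : ℕ+) :=
      fun t => if a t then ⟨1, by simp⟩ else ⟨0, by simp⟩
    have hm : L.minion.minor α v = e (v.1 a) hle := by
      apply Subtype.ext
      funext b
      change v.1 (fun t => b (α t)) = pairLevel L.top (v.1 a) (b ⟨0, by simp⟩) (b ⟨1, by simp⟩)
      have hα : (fun t => b (α t)) =
          fun t => if a t then b ⟨1, by simp⟩ else b ⟨0, by simp⟩ := by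
        funext t
        by_cases h : a t <;> simp [α, h]
      refine (congrArg v.1 hα).trans ?_
      have hneg := v.2.2.1 a
      cases b ⟨0, by simp⟩ <;> cases b ⟨1, by simp⟩
      · simpa [pairLevel] using v.2.1
      · simp [pairLevel]
      · have : (fun t => if a t = true then false else true) = fun t => !(a t) := by
          funext t
          cases a t <;> rfl
        rw [this]
        simp only [pairLevel]
        omega
      · simpa [pairLevel] using v.2.map_true
    have h := congrArg (fun w => w.1 (fun t => decide (t.val = 1))) (ξ.map_minor α v)
    simp only [hm] at h
    simp only [φ, dif_pos hle]
    rw [h]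
    refine (congrArg (ξ.toFun n v).1 (?_ : a = fun t => decide ((α t).val = 1)))
    funext t
    by_cases h : a t
    · simp only [α, if_pos h, decide_true, h]
    · simp [α, h]
  refine ⟨φ, key, ?_, ?_, ?_⟩
  · exact (key _ (e 0 (Nat.zero_le _)) fun _ => false).symm.trans (ξ.toFun _ _).2.1
  · intro i hi
    have h := (ξ.toFun _ (e i hi)).2.2.1 (fun t => decide (t.val = 1))
    exact (congrArg₂ (· + ·) (key _ (e i hi) _) (key _ (e i hi) _)).symm.trans h
  · intro i hi j hj hij
    let w : L.minion.carrier ⟨3, three_pos⟩ := ⟨_, L.isLevelMap_triple hi hj hij⟩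
    have h := (ξ.toFun _ w).2.2.2 (fun t => decide (t.val = 0)) (fun t => decide (t.val ≤ 1))
      (fun t => by
        rcases t with ⟨t, ht⟩
        rcases t with _ | t
        · exact le_rfl
        · exact Bool.false_le _)
    exact (congrArg₂ L'.rel (key _ w _) (key _ w _)).mp h

/-! ### The listed minions as level minions -/

/-- The level structure describing a listed minion. -/
def CoreName.level : CoreName → LevelStructure
  | .T => ⟨0, fun _ _ => True, by simp, by simp, by simp, by simp⟩
  -- A step $\triangleleft$ between neighbours of the chain permits a drop by one level. Since only
  -- $h_k\le h_k^d$ is required, the drop from $k+1$ to $k-1$ is also free.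
  | .A k _ => ⟨2 * k, fun i j => i ≤ j + 1 ∨ (i = k + 1 ∧ j + 1 = k),
      by omega, by omega, by omega, by omega⟩
  | .B k _ => ⟨2 * k, fun i j => i ≤ j + 1, by omega, by omega, by omega, by omega⟩
  -- The middle operation $h_k$ is linked to its neighbours only by $\le$; this allows the two drops
  -- by two levels, to and from the sides of the threshold $k$.
  | .C k _ => ⟨2 * k - 1, fun i j => i ≤ j + 1 ∨ (i = k ∧ j + 2 = k) ∨ (i = k + 1 ∧ j + 1 = k),
      by omega, by omega, by omega, by omega⟩
  | .D k _ => ⟨2 * k - 1, fun i j => i ≤ j + 1, by omega, by omega, by omega, by omega⟩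
  | .BInf => ⟨2, fun i j => i ≤ j, by omega, by omega, by omega, by omega⟩
  | .CInf => ⟨3, fun i j => i ≤ j ∨ (i = 2 ∧ j = 1), by omega, by omega, by omega, by omega⟩
  | .DInf => ⟨1, fun i j => i ≤ j, by omega, by omega, by omega, by omega⟩

theorem Bool.le_iff_of_imp {x y : Bool} : x ≤ y ↔ (x = true → y = true) := by
  cases x <;> cases y <;> simp

theorem compl_le_compl_of_le {n : ℕ} {a b : Fin n → Bool} (h : a ≤ b) :
    (fun i => !(b i)) ≤ (fun i => !(a i)) := fun i => by
  have := h i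
  revert this
  dsimp only
  cases a i <;> cases b i <;> simp

/-- A chain of Boolean operations is encoded by levels. -/
theorem exists_level_of_chain {k m : ℕ} (hkm : k ≤ m) (hm : m ≤ 2 * k) (hm' : 2 * k ≤ m + 1)
    {n : ℕ+} (h : SortedBoolOp k n)
    (hchain : ∀ i j : Fin k, (i : ℕ) ≤ j → h i ≤ h j)
    (hdual : ∀ i j : Fin k, h i ≤ (h j).dual)
    (hself : ∀ i : Fin k, (i : ℕ) + 1 = k → m + 1 = 2 * k → h i = (h i).dual) :
    ∃ v : (Fin n → Bool) → ℕ, (∀ a, v a + v (fun i => !(a i)) = m) ∧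
      ∀ a (i : Fin k), h i a = true ↔ m - i ≤ v a := by
  classical
  have hd : ∀ (i j : Fin k) a, h i a = true → h j (fun t => !(a t)) = false := by
    intro i j a hi
    have := Bool.le_iff_of_imp.mp (hdual i j a) hi
    simpa [Operation.dual] using this
  have hs : ∀ (i : Fin k) a, (i : ℕ) + 1 = k → m + 1 = 2 * k →
      (h i a = true ↔ h i (fun t => !(a t)) = false) := by
    intro i a h1 h2
    have := congrFun (hself i h1 h2) a
    rw [this]
    simp [Operation.dual]
  -- Threshold $m-i$ stands for `h i` and threshold $i+1$ for its dual. Together they exhaust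
  -- $1,\dots,m$; for odd $m$ the middle threshold has both descriptions, which agree by `hs`.
  let θ : (Fin n → Bool) → ℕ → Prop := fun a τ =>
    (∃ i : Fin k, m - i = τ ∧ h i a = true) ∨
      ∃ i : Fin k, (i : ℕ) + 1 = τ ∧ h i (fun t => !(a t)) = false
  have hθanti : ∀ a τ σ, 1 ≤ σ → σ ≤ τ → θ a τ → θ a σ := by
    rintro a τ σ h1 hστ (⟨i, hi, hia⟩ | ⟨i, hi, hia⟩)
    · by_cases hσ : m - σ < k
      · refine Or.inl ⟨⟨m - σ, hσ⟩, ?_, ?_⟩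
        · change m - (m - σ) = σ
          omega
        · refine Bool.le_iff_of_imp.mp (hchain i _ ?_ a) hia
          change (i : ℕ) ≤ m - σ
          omega
      · refine Or.inr ⟨⟨σ - 1, by omega⟩, ?_, hd _ _ _ hia⟩
        change σ - 1 + 1 = σ
        omega
    · have hik := i.2
      refine Or.inr ⟨⟨σ - 1, by omega⟩, ?_, ?_⟩
      · change σ - 1 + 1 = σ
        omega
      · have := hchain ⟨σ - 1, by omega⟩ i (by change σ - 1 ≤ (i : ℕ); omega) (fun t => !(a t))
        rw [Bool.le_iff_of_imp] at this
        by_contra hne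
        exact absurd (this (by simpa using hne)) (by simp [hia])
  have hθi : ∀ a (i : Fin k), θ a (m - i) ↔ h i a = true := by
    intro a i
    constructor
    · rintro (⟨j, hj, hja⟩ | ⟨j, hj, hja⟩)
      · have : j = i := by
          apply Fin.ext
          have := i.2
          have := j.2
          omega
        rwa [this] at hja
      · have hi := i.2
        have hj' := j.2
        have hji : j = i := Fin.ext (by omega)
        subst hji
        exact (hs j a (by omega) (by omega)).mpr hja
    · exact fun hia => Or.inl ⟨i, rfl, hia⟩
  have hθd : ∀ a (i : Fin k), θ a (i + 1) ↔ h i (fun t => !(a t)) = false := by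
    intro a i
    constructor
    · rintro (⟨j, hj, hja⟩ | ⟨j, hj, hja⟩)
      · exact hd _ _ _ hja
      · have : j = i := Fin.ext (by omega)
        rwa [this] at hja
    · exact fun hia => Or.inr ⟨i, rfl, hia⟩
  -- Complementation exchanges the thresholds $\tau$ and $m+1-\tau$; this is what makes the two
  -- levels add up to $m$.
  have hcompl : ∀ a τ, 1 ≤ τ → τ ≤ m → (θ a τ ↔ ¬ θ (fun t => !(a t)) (m + 1 - τ)) := by
    intro a τ h1 h2
    by_cases hτ : m - τ < k
    · have e1 : m - ((⟨m - τ, hτ⟩ : Fin k) : ℕ) = τ := by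
        change m - (m - τ) = τ
        omega
      have e2 : ((⟨m - τ, hτ⟩ : Fin k) : ℕ) + 1 = m + 1 - τ := by
        change m - τ + 1 = m + 1 - τ
        omega
      have := hθi a ⟨m - τ, hτ⟩
      rw [e1] at this
      rw [this, ← e2, hθd]
      simp
    · have hτ' : τ - 1 < k := by omega
      have e1 : ((⟨τ - 1, hτ'⟩ : Fin k) : ℕ) + 1 = τ := by
        change τ - 1 + 1 = τ
        omega
      have e2 : m - ((⟨τ - 1, hτ'⟩ : Fin k) : ℕ) = m + 1 - τ := by
        change m - (τ - 1) = m + 1 - τ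
        omega
      have := hθd a ⟨τ - 1, hτ'⟩
      rw [e1] at this
      rw [this, ← e2, hθi]
      simp
  let v : (Fin n → Bool) → ℕ := fun a => Nat.findGreatest (θ a) m
  have hv : ∀ a τ, 1 ≤ τ → τ ≤ m → (τ ≤ v a ↔ θ a τ) := by
    intro a τ h1 h2
    constructor
    · intro hle
      exact hθanti a (v a) τ h1 hle (Nat.findGreatest_of_ne_zero (P := θ a) (n := m) rfl (by omega))
    · exact fun hθ => Nat.le_findGreatest h2 hθ
  refine ⟨v, fun a => ?_, fun a i => ?_⟩
  · have hle : ∀ a, v a ≤ m := fun a => Nat.findGreatest_le _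
    have h1 := hle a
    have h2 := hle (fun i => !(a i))
    by_contra hne
    rcases Nat.lt_or_gt_of_ne hne with hlt | hgt
    · have c1 := hcompl a (v a + 1) (by omega) (by omega)
      rw [← hv _ _ (by omega) (by omega), ← hv _ _ (by omega) (by omega)] at c1
      omega
    · have c1 := hcompl a (v a) (by omega) (by omega)
      rw [← hv _ _ (by omega) (by omega), ← hv _ _ (by omega) (by omega)] at c1
      omega
  · have := i.2
    rw [hv _ _ (by omega) (by omega), hθi]

/-- A Boolean minion of chains is a retract of a level minion. -/
theorem exists_level_retract {k : ℕ} {P : ∀ n : ℕ+, SortedBoolOp k n → Prop}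
    {hproj : ∀ (n : ℕ+) (i : Fin n), P n (fun _ => Operation.proj Bool i)}
    {hminor : ∀ (n m : ℕ+) (α : Fin n → Fin m) (h : SortedBoolOp k n), P n h →
      P m (fun s => (h s).minor α)} (L : LevelStructure)
    (hk : 1 ≤ k) (hm : L.top ≤ 2 * k) (hm' : 2 * k ≤ L.top + 1)
    (hchain : ∀ n h, P n h → ∀ i j : Fin k, (i : ℕ) ≤ j → h i ≤ h j)
    (hdual : ∀ n h, P n h → ∀ i j : Fin k, h i ≤ (h j).dual)
    (hself : ∀ n h, P n h → ∀ i : Fin k, (i : ℕ) + 1 = k → L.top + 1 = 2 * k →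
      h i = (h i).dual)
    (hrel : ∀ n h, P n h → ∀ v : (Fin n → Bool) → ℕ, (∀ a, v a + v (fun i => !(a i)) = L.top) →
      (∀ a (i : Fin k), h i a = true ↔ L.top - i ≤ v a) → ∀ a b, a ≤ b → L.rel (v a) (v b))
    (hback : ∀ (n : ℕ+) (v : (Fin n → Bool) → ℕ), L.IsLevelMap v →
      P n (fun i a => decide (L.top - i ≤ v a))) :
    ∃ (F : MinionHom (boolMinion k P hproj hminor) L.minion)
      (F' : MinionHom L.minion (boolMinion k P hproj hminor)), F'.comp F = MinionHom.id _ := by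
  have hex : ∀ (n : ℕ+) (h : (boolMinion k P hproj hminor).carrier n),
      ∃ v : (Fin n → Bool) → ℕ, L.IsLevelMap v ∧
        ∀ a (i : Fin k), h.1 i a = true ↔ L.top - i ≤ v a := by
    intro n h
    obtain ⟨v, hv, hv'⟩ := exists_level_of_chain (by omega) hm hm' h.1 (hchain n _ h.2.2)
      (hdual n _ h.2.2) (hself n _ h.2.2)
    refine ⟨v, ⟨?_, hv, hrel n _ h.2.2 v hv hv'⟩, hv'⟩
    have h1 := hv (fun _ => false)
    have h2 := hv' (fun _ => true) ⟨0, hk⟩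
    simp only [h.2.1 _ true, true_iff] at h2
    simp only [Bool.not_false] at h1
    change L.top - 0 ≤ _ at h2
    omega
  choose V hV hV' using hex
  -- The upper thresholds determine the level map, because the lower ones are seen at the
  -- complement. This gives compatibility with minors although `V` was chosen.
  have huniq : ∀ (n : ℕ+) (v w : (Fin n → Bool) → ℕ), L.IsLevelMap v → L.IsLevelMap w →
      (∀ a (i : Fin k), L.top - i ≤ v a ↔ L.top - i ≤ w a) → v = w := by
    intro n v w hv hw hvw
    have hlt : ∀ v w : (Fin n → Bool) → ℕ, L.IsLevelMap v → L.IsLevelMap w →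
        (∀ a (i : Fin k), L.top - i ≤ v a ↔ L.top - i ≤ w a) → ∀ a, v a ≤ w a := by
      intro v w hv hw hvw a
      by_contra hlt
      have h1 := hv.2.1 a
      have h2 := hw.2.1 a
      by_cases hc : L.top - v a < k
      · have := hvw a ⟨L.top - v a, hc⟩
        dsimp only at this
        omega
      · have := hvw (fun i => !(a i)) ⟨w a, by omega⟩
        dsimp only at this
        omega
    exact funext fun a => le_antisymm (hlt v w hv hw hvw a)
      (hlt w v hw hv (fun a i => (hvw a i).symm) a)
  refine ⟨⟨fun n h => ⟨V n h, hV n h⟩, fun {n m} α h => Subtype.ext ?_⟩,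
    ⟨fun n v => ⟨fun i a => decide (L.top - i ≤ v.1 a), fun i b => ?_, hback n _ v.2⟩,
      fun _ _ => rfl⟩, ?_⟩
  · refine huniq _ _ _ (hV _ _) ((hV n h).minor α) fun a i => ?_
    exact (hV' m _ a i).symm.trans (hV' n h (fun t => a (α t)) i)
  · have := i.2
    cases b
    · have h0 : v.1 (fun _ => false) = 0 := v.2.1
      exact decide_eq_false (by omega)
    · have h0 : v.1 (fun _ => true) = L.top := v.2.map_true
      exact decide_eq_true (by omega)
  · ext n h
    refine Subtype.ext (funext fun i => funext fun a => ?_)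
    change decide (L.top - i ≤ V n h a) = h.1 i a
    rw [Bool.eq_iff_iff, decide_eq_true_iff, hV' n h]

/-! ### Calculus of `Tri`, duals and thresholds. -/

theorem Operation.Tri.le {n : ℕ+} {f g : Operation Bool n} (h : f.Tri g) : f ≤ g :=
  fun a => h a a le_rfl

theorem Operation.dual_dual {n : ℕ+} (f : Operation Bool n) : f.dual.dual = f := by
  funext a
  simp [Operation.dual]

theorem Operation.dual_le_dual {n : ℕ+} {f g : Operation Bool n} (h : f ≤ g) :
    g.dual ≤ f.dual := fun a => by
  have := h (fun i => !(a i))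
  revert this
  simp only [Operation.dual]
  cases f (fun i => !(a i)) <;> cases g (fun i => !(a i)) <;> simp

theorem Operation.Tri.dual {n : ℕ+} {f g : Operation Bool n} (h : f.Tri g) :
    g.dual.Tri f.dual := fun a b hab => by
  have := h _ _ (compl_le_compl_of_le hab)
  revert this
  simp only [Operation.dual]
  cases f (fun i => !(b i)) <;> cases g (fun i => !(a i)) <;> simp

theorem Operation.Tri.trans_le {n : ℕ+} {f g h : Operation Bool n} (hfg : f.Tri g) (hgh : g ≤ h) :
    f.Tri h := fun a b hab => (hfg a b hab).trans (hgh b)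

theorem Operation.Tri.trans {n : ℕ+} {f g h : Operation Bool n} (hfg : f.Tri g) (hgh : g.Tri h) :
    f.Tri h := hfg.trans_le hgh.le

theorem Operation.tri_iff_of_levels {n : ℕ+} {f g : Operation Bool n} {v : (Fin n → Bool) → ℕ}
    {s t : ℕ} (hf : ∀ a, f a = true ↔ s ≤ v a) (hg : ∀ a, g a = true ↔ t ≤ v a) :
    f.Tri g ↔ ∀ a b, a ≤ b → s ≤ v a → t ≤ v b := by
  simp only [Operation.Tri, Bool.le_iff_of_imp, hf, hg]

theorem Operation.dual_iff_of_levels {n : ℕ+} {f : Operation Bool n} {v : (Fin n → Bool) → ℕ}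
    {s m : ℕ} (hf : ∀ a, f a = true ↔ s ≤ v a) (hv : ∀ a, v a + v (fun i => !(a i)) = m) (a) :
    f.dual a = true ↔ m + 1 - s ≤ v a := by
  have := hv a
  simp only [Operation.dual, Bool.not_eq_true', ← Bool.not_eq_true, hf]
  omega

theorem chain_le_of_step {k : ℕ} {n : ℕ+} {h : SortedBoolOp k n}
    (hstep : ∀ i j : Fin k, (i : ℕ) + 1 = j → h i ≤ h j) (i j : Fin k) (hij : (i : ℕ) ≤ j) :
    h i ≤ h j := by
  obtain ⟨d, hd⟩ := Nat.exists_eq_add_of_le hij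
  induction d generalizing j with
  | zero => rw [Fin.ext (show (j : ℕ) = i by omega)]
  | succ d ih =>
    have hj := j.2
    exact (ih ⟨i + d, by omega⟩ (by simp) rfl).trans (hstep _ _ (by simp only; omega))

theorem chain_le_dual {k : ℕ} {n : ℕ+} {h : SortedBoolOp k n}
    (hchain : ∀ i j : Fin k, (i : ℕ) ≤ j → h i ≤ h j)
    (hlast : ∀ i : Fin k, (i : ℕ) + 1 = k → h i ≤ (h i).dual) (i j : Fin k) :
    h i ≤ (h j).dual := by
  have hi := i.2
  have hj := j.2
  have h1 := hchain i ⟨k - 1, by omega⟩ (by simp only; omega)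
  have h2 := hchain j ⟨k - 1, by omega⟩ (by simp only; omega)
  exact h1.trans ((hlast ⟨k - 1, by omega⟩ (by simp only; omega)).trans
    (Operation.dual_le_dual h2))

/-! ### Each listed minion as a retract of its level minion. -/

theorem exists_retract_minionT : ∃ (F : MinionHom minionT CoreName.T.level.minion)
    (F' : MinionHom CoreName.T.level.minion minionT), F'.comp F = MinionHom.id _ :=
  ⟨⟨fun _ _ => ⟨fun _ => 0, rfl, fun _ => rfl, fun _ _ _ => trivial⟩, fun _ _ => rfl⟩,
    ⟨fun _ _ => fun _ => (), fun _ _ => rfl⟩, rfl⟩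

theorem exists_retract_minionA (k : ℕ) (hk : 1 ≤ k) :
    ∃ (F : MinionHom (minionA k) (CoreName.A k hk).level.minion)
    (F' : MinionHom (CoreName.A k hk).level.minion (minionA k)), F'.comp F = MinionHom.id _ := by
  have hc : ∀ n h, CondA k n h → ∀ i j : Fin k, (i : ℕ) ≤ j → h i ≤ h j :=
    fun n h hh => chain_le_of_step fun i j hij => (hh.1 i j hij).le
  refine exists_level_retract _ hk le_rfl (Nat.le_succ _) hc
    (fun n h hh => chain_le_dual (hc n h hh) hh.2) ?_ ?_ ?_
  · intro n h hh i hi hk'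
    change 2 * k + 1 = 2 * k at hk'
    omega
  · intro n h hh v hv hhv a b hab
    change ∀ a, v a + v (fun i => !(a i)) = 2 * k at hv
    change ∀ a (i : Fin k), h i a = true ↔ 2 * k - i ≤ v a at hhv
    change v a ≤ v b + 1 ∨ (v a = k + 1 ∧ v b + 1 = k)
    have hstep : ∀ i, i + 1 < k → ∀ a b, a ≤ b → 2 * k - i ≤ v a → 2 * k - (i + 1) ≤ v b :=
      fun i hi => (Operation.tri_iff_of_levels (fun a => hhv a ⟨i, by omega⟩)
        (fun a => hhv a ⟨i + 1, hi⟩)).mp (hh.1 _ _ rfl)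
    -- `h1` treats levels `v a` above $k+1$; `h2` is the same condition at the complements and
    -- treats levels `v b` below $k-1$. What remains is the permitted exception.
    have h1 := fun h => hstep (2 * k - v a) h a b hab
    have h2 := fun h => hstep (v b) h _ _ (compl_le_compl_of_le hab)
    have h3 := hv a
    have h4 := hv b
    omega
  · intro n v hv
    have hv2 : ∀ a, v a + v (fun i => !(a i)) = 2 * k := hv.2.1
    have hv3 : ∀ a b, a ≤ b → v a ≤ v b + 1 ∨ (v a = k + 1 ∧ v b + 1 = k) := hv.2.2
    refine ⟨fun i j hij => (Operation.tri_iff_of_levels (v := v) (fun a => decide_eq_true_iff)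
      (fun a => decide_eq_true_iff)).mpr fun a b hab => ?_, fun i hi a => ?_⟩
    · change 2 * k - (i : ℕ) ≤ v a → 2 * k - (j : ℕ) ≤ v b
      have := hv3 a b hab
      omega
    · rw [Bool.le_iff_of_imp, Operation.dual_iff_of_levels (fun a => decide_eq_true_iff) hv2,
        decide_eq_true_iff]
      change 2 * k - (i : ℕ) ≤ v a → 2 * k + 1 - (2 * k - (i : ℕ)) ≤ v a
      omega

theorem exists_retract_minionB (k : ℕ) (hk : 1 ≤ k) :
    ∃ (F : MinionHom (minionB k) (CoreName.B k hk).level.minion)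
    (F' : MinionHom (CoreName.B k hk).level.minion (minionB k)), F'.comp F = MinionHom.id _ := by
  have hc : ∀ n h, CondB k n h → ∀ i j : Fin k, (i : ℕ) ≤ j → h i ≤ h j :=
    fun n h hh => chain_le_of_step fun i j hij => (hh.1 i j hij).le
  refine exists_level_retract _ hk le_rfl (Nat.le_succ _) hc
    (fun n h hh => chain_le_dual (hc n h hh) fun i hi => (hh.2 i hi).le) ?_ ?_ ?_
  · intro n h hh i hi hk'
    change 2 * k + 1 = 2 * k at hk'
    omega
  · intro n h hh v hv hhv a b hab
    change ∀ a, v a + v (fun i => !(a i)) = 2 * k at hv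
    change ∀ a (i : Fin k), h i a = true ↔ 2 * k - i ≤ v a at hhv
    change v a ≤ v b + 1
    have hstep : ∀ i, i + 1 < k → ∀ a b, a ≤ b → 2 * k - i ≤ v a → 2 * k - (i + 1) ≤ v b :=
      fun i hi => (Operation.tri_iff_of_levels (fun a => hhv a ⟨i, by omega⟩)
        (fun a => hhv a ⟨i + 1, hi⟩)).mp (hh.1 _ _ rfl)
    have hlast := (Operation.tri_iff_of_levels (fun a => hhv a ⟨k - 1, by omega⟩)
      (Operation.dual_iff_of_levels (fun a => hhv a ⟨k - 1, by omega⟩) hv)).mp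
        (hh.2 ⟨k - 1, by omega⟩ (by simp only; omega)) a b hab
    simp only at hlast
    have h1 := fun h => hstep (2 * k - v a) h a b hab
    have h2 := fun h => hstep (v b) h _ _ (compl_le_compl_of_le hab)
    have h3 := hv a
    have h4 := hv b
    omega
  · intro n v hv
    have hv2 : ∀ a, v a + v (fun i => !(a i)) = 2 * k := hv.2.1
    have hv3 : ∀ a b, a ≤ b → v a ≤ v b + 1 := hv.2.2
    refine ⟨fun i j hij => (Operation.tri_iff_of_levels (v := v) (fun a => decide_eq_true_iff)
      (fun a => decide_eq_true_iff)).mpr fun a b hab => ?_,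
      fun i hi => (Operation.tri_iff_of_levels (v := v) (fun a => decide_eq_true_iff)
        (Operation.dual_iff_of_levels (fun a => decide_eq_true_iff) hv2)).mpr fun a b hab => ?_⟩
    · change 2 * k - (i : ℕ) ≤ v a → 2 * k - (j : ℕ) ≤ v b
      have := hv3 a b hab
      omega
    · change 2 * k - (i : ℕ) ≤ v a → 2 * k + 1 - (2 * k - (i : ℕ)) ≤ v b
      have := hv3 a b hab
      omega

theorem exists_retract_minionD (k : ℕ) (hk : 1 ≤ k) :
    ∃ (F : MinionHom (minionD k) (CoreName.D k hk).level.minion)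
    (F' : MinionHom (CoreName.D k hk).level.minion (minionD k)), F'.comp F = MinionHom.id _ := by
  have hc : ∀ n h, CondD k n h → ∀ i j : Fin k, (i : ℕ) ≤ j → h i ≤ h j :=
    fun n h hh => chain_le_of_step fun i j hij => (hh.1 i j hij).le
  refine exists_level_retract _ hk ?_ ?_ hc
    (fun n h hh => chain_le_dual (hc n h hh) fun i hi => (hh.2 i hi).le)
    (fun n h hh i hi _ => hh.2 i hi) ?_ ?_
  · change 2 * k - 1 ≤ 2 * k
    omega
  · change 2 * k ≤ 2 * k - 1 + 1
    omega
  · intro n h hh v hv hhv a b hab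
    change ∀ a, v a + v (fun i => !(a i)) = 2 * k - 1 at hv
    change ∀ a (i : Fin k), h i a = true ↔ 2 * k - 1 - i ≤ v a at hhv
    change v a ≤ v b + 1
    have hstep : ∀ i, i + 1 < k → ∀ a b, a ≤ b →
        2 * k - 1 - i ≤ v a → 2 * k - 1 - (i + 1) ≤ v b :=
      fun i hi => (Operation.tri_iff_of_levels (fun a => hhv a ⟨i, by omega⟩)
        (fun a => hhv a ⟨i + 1, hi⟩)).mp (hh.1 _ _ rfl)
    have h1 := fun h => hstep (2 * k - 1 - v a) h a b hab
    have h2 := fun h => hstep (v b) h _ _ (compl_le_compl_of_le hab)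
    have h3 := hv a
    have h4 := hv b
    omega
  · intro n v hv
    have hv2 : ∀ a, v a + v (fun i => !(a i)) = 2 * k - 1 := hv.2.1
    have hv3 : ∀ a b, a ≤ b → v a ≤ v b + 1 := hv.2.2
    refine ⟨fun i j hij => (Operation.tri_iff_of_levels (v := v) (fun a => decide_eq_true_iff)
      (fun a => decide_eq_true_iff)).mpr fun a b hab => ?_, fun i hi => funext fun a => ?_⟩
    · change 2 * k - 1 - (i : ℕ) ≤ v a → 2 * k - 1 - (j : ℕ) ≤ v b
      have := hv3 a b hab
      omega
    · rw [Bool.eq_iff_iff, Operation.dual_iff_of_levels (fun a => decide_eq_true_iff) hv2,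
        decide_eq_true_iff]
      change 2 * k - 1 - (i : ℕ) ≤ v a ↔ 2 * k - 1 + 1 - (2 * k - 1 - (i : ℕ)) ≤ v a
      omega

theorem exists_retract_minionC (k : ℕ) (hk : 2 ≤ k) :
    ∃ (F : MinionHom (minionC k) (CoreName.C k hk).level.minion)
    (F' : MinionHom (CoreName.C k hk).level.minion (minionC k)), F'.comp F = MinionHom.id _ := by
  have hc : ∀ n h, CondC k n h → ∀ i j : Fin k, (i : ℕ) ≤ j → h i ≤ h j := by
    refine fun n h hh => chain_le_of_step fun i j hij => ?_
    by_cases hj : (j : ℕ) + 1 < k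
    · exact (hh.1 i j hij hj).le
    · exact hh.2.1 i j hij (by omega)
  refine exists_level_retract _ (by omega) ?_ ?_ hc
    (fun n h hh => chain_le_dual (hc n h hh) fun i hi => (hh.2.2.1 i hi).le)
    (fun n h hh i hi _ => hh.2.2.1 i hi) ?_ ?_
  · change 2 * k - 1 ≤ 2 * k
    omega
  · change 2 * k ≤ 2 * k - 1 + 1
    omega
  · intro n h hh v hv hhv a b hab
    change ∀ a, v a + v (fun i => !(a i)) = 2 * k - 1 at hv
    change ∀ a (i : Fin k), h i a = true ↔ 2 * k - 1 - i ≤ v a at hhv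
    change v a ≤ v b + 1 ∨ (v a = k ∧ v b + 2 = k) ∨ (v a = k + 1 ∧ v b + 1 = k)
    have hstep : ∀ i, i + 2 < k → ∀ a b, a ≤ b →
        2 * k - 1 - i ≤ v a → 2 * k - 1 - (i + 1) ≤ v b :=
      fun i hi => (Operation.tri_iff_of_levels (fun a => hhv a ⟨i, by omega⟩)
        (fun a => hhv a ⟨i + 1, by omega⟩)).mp (hh.1 _ _ rfl hi)
    have hlast := (Operation.tri_iff_of_levels (fun a => hhv a ⟨k - 2, by omega⟩)
      (Operation.dual_iff_of_levels (fun a => hhv a ⟨k - 2, by omega⟩) hv)).mp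
        (hh.2.2.2 ⟨k - 2, by omega⟩ (by simp only; omega)) a b hab
    simp only at hlast
    have h1 := fun h => hstep (2 * k - 1 - v a) h a b hab
    have h2 := fun h => hstep (v b) h _ _ (compl_le_compl_of_le hab)
    have h3 := hv a
    have h4 := hv b
    omega
  · intro n v hv
    have hv2 : ∀ a, v a + v (fun i => !(a i)) = 2 * k - 1 := hv.2.1
    have hv3 : ∀ a b, a ≤ b →
      v a ≤ v b + 1 ∨ (v a = k ∧ v b + 2 = k) ∨ (v a = k + 1 ∧ v b + 1 = k) := hv.2.2
    refine ⟨fun i j hij hj => (Operation.tri_iff_of_levels (v := v) (fun a => decide_eq_true_iff)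
      (fun a => decide_eq_true_iff)).mpr fun a b hab => ?_, fun i j hij hj a => ?_,
      fun i hi => funext fun a => ?_,
      fun i hi => (Operation.tri_iff_of_levels (v := v) (fun a => decide_eq_true_iff)
        (Operation.dual_iff_of_levels (fun a => decide_eq_true_iff) hv2)).mpr fun a b hab => ?_⟩
    · change 2 * k - 1 - (i : ℕ) ≤ v a → 2 * k - 1 - (j : ℕ) ≤ v b
      have := hv3 a b hab
      omega
    · rw [Bool.le_iff_of_imp, decide_eq_true_iff, decide_eq_true_iff]
      change 2 * k - 1 - (i : ℕ) ≤ v a → 2 * k - 1 - (j : ℕ) ≤ v a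
      omega
    · rw [Bool.eq_iff_iff, Operation.dual_iff_of_levels (fun a => decide_eq_true_iff) hv2,
        decide_eq_true_iff]
      change 2 * k - 1 - (i : ℕ) ≤ v a ↔ 2 * k - 1 + 1 - (2 * k - 1 - (i : ℕ)) ≤ v a
      omega
    · change 2 * k - 1 - (i : ℕ) ≤ v a → 2 * k - 1 + 1 - (2 * k - 1 - (i : ℕ)) ≤ v b
      have := hv3 a b hab
      omega

theorem exists_retract_minionBInf : ∃ (F : MinionHom minionBInf CoreName.BInf.level.minion)
    (F' : MinionHom CoreName.BInf.level.minion minionBInf), F'.comp F = MinionHom.id _ := by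
  refine exists_level_retract _ le_rfl le_rfl (Nat.le_succ _) ?_ ?_ ?_ ?_ ?_
  · intro n h hh i j _
    rw [Subsingleton.elim i j]
  · intro n h hh i j
    rw [Subsingleton.elim i 0, Subsingleton.elim j 0]
    exact hh.2.le
  · intro n h hh i hi hk
    exact absurd hk (by decide)
  · intro n h hh v hv hhv a b hab
    change ∀ a, v a + v (fun i => !(a i)) = 2 at hv
    have hhv' : ∀ a, h 0 a = true ↔ 2 ≤ v a := fun a => hhv a 0
    change v a ≤ v b
    have h1 := (Operation.tri_iff_of_levels hhv' hhv').mp hh.1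
    have h2 := h1 a b hab
    have h3 := h1 _ _ (compl_le_compl_of_le hab)
    have h4 := hv a
    have h5 := hv b
    omega
  · intro n v hv
    have hv2 : ∀ a, v a + v (fun i => !(a i)) = 2 := hv.2.1
    have hv3 : ∀ a b, a ≤ b → v a ≤ v b := hv.2.2
    have he : ∀ a, decide (CoreName.BInf.level.top - ((0 : Fin 1) : ℕ) ≤ v a) = true ↔ 2 ≤ v a :=
      fun a => decide_eq_true_iff
    refine ⟨(Operation.tri_iff_of_levels he he).mpr fun a b hab => ?_,
      (Operation.tri_iff_of_levels he (Operation.dual_iff_of_levels he hv2)).mpr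
        fun a b hab => ?_⟩
    · have := hv3 a b hab
      omega
    · have := hv3 a b hab
      omega

theorem exists_retract_minionCInf : ∃ (F : MinionHom minionCInf CoreName.CInf.level.minion)
    (F' : MinionHom CoreName.CInf.level.minion minionCInf), F'.comp F = MinionHom.id _ := by
  have hc : ∀ n h, CondCInf n h → ∀ i j : Fin 2, (i : ℕ) ≤ j → h i ≤ h j := by
    refine fun n h hh => chain_le_of_step fun i j hij => ?_
    have hi : i = 0 := Fin.ext (by have := j.2; simp only [Fin.val_zero]; omega)
    have hj : j = 1 := Fin.ext (by have := j.2; simp only [Fin.val_one]; omega)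
    subst hi hj
    exact hh.2.1.le
  refine exists_level_retract _ (by decide) (by decide) (by decide) hc ?_ ?_ ?_ ?_
  · refine fun n h hh => chain_le_dual (hc n h hh) fun i hi => ?_
    have hi : i = 1 := Fin.ext (by simp only [Fin.val_one]; omega)
    subst hi
    exact hh.2.2.le
  · intro n h hh i hi _
    have hi : i = 1 := Fin.ext (by simp only [Fin.val_one]; omega)
    subst hi
    exact hh.2.2
  · intro n h hh v hv hhv a b hab
    change ∀ a, v a + v (fun i => !(a i)) = 3 at hv
    have h0 : ∀ a, h 0 a = true ↔ 3 ≤ v a := fun a => hhv a 0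
    have h1 : ∀ a, h 1 a = true ↔ 2 ≤ v a := fun a => hhv a 1
    change v a ≤ v b ∨ (v a = 2 ∧ v b = 1)
    have h2 := (Operation.tri_iff_of_levels h0 h0).mp hh.1
    have h3 := (Operation.tri_iff_of_levels h0 h1).mp hh.2.1
    have h4 := h2 a b hab
    have h5 := h2 _ _ (compl_le_compl_of_le hab)
    have h6 := h3 a b hab
    have h7 := h3 _ _ (compl_le_compl_of_le hab)
    have h8 := hv a
    have h9 := hv b
    omega
  · intro n v hv
    have hv2 : ∀ a, v a + v (fun i => !(a i)) = 3 := hv.2.1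
    have hv3 : ∀ a b, a ≤ b → v a ≤ v b ∨ (v a = 2 ∧ v b = 1) := hv.2.2
    have h0 : ∀ a, decide (CoreName.CInf.level.top - ((0 : Fin 2) : ℕ) ≤ v a) = true ↔ 3 ≤ v a :=
      fun a => decide_eq_true_iff
    have h1 : ∀ a, decide (CoreName.CInf.level.top - ((1 : Fin 2) : ℕ) ≤ v a) = true ↔ 2 ≤ v a :=
      fun a => decide_eq_true_iff
    refine ⟨(Operation.tri_iff_of_levels h0 h0).mpr fun a b hab => ?_,
      (Operation.tri_iff_of_levels h0 h1).mpr fun a b hab => ?_, funext fun a => ?_⟩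
    · have := hv3 a b hab
      omega
    · have := hv3 a b hab
      omega
    · rw [Bool.eq_iff_iff, Operation.dual_iff_of_levels h1 hv2, h1]

theorem exists_retract_minionDInf : ∃ (F : MinionHom minionDInf CoreName.DInf.level.minion)
    (F' : MinionHom CoreName.DInf.level.minion minionDInf), F'.comp F = MinionHom.id _ := by
  refine exists_level_retract _ le_rfl (by decide) le_rfl ?_ ?_ ?_ ?_ ?_
  · intro n h hh i j _
    rw [Subsingleton.elim i j]
  · intro n h hh i j
    rw [Subsingleton.elim i 0, Subsingleton.elim j 0]
    exact hh.2.le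
  · intro n h hh i _ _
    rw [Subsingleton.elim i 0]
    exact hh.2
  · intro n h hh v hv hhv a b hab
    change ∀ a, v a + v (fun i => !(a i)) = 1 at hv
    have hhv' : ∀ a, h 0 a = true ↔ 1 ≤ v a := fun a => hhv a 0
    change v a ≤ v b
    have h1 := (Operation.tri_iff_of_levels hhv' hhv').mp hh.1 a b hab
    have h4 := hv a
    omega
  · intro n v hv
    have hv2 : ∀ a, v a + v (fun i => !(a i)) = 1 := hv.2.1
    have hv3 : ∀ a b, a ≤ b → v a ≤ v b := hv.2.2
    have he : ∀ a, decide (CoreName.DInf.level.top - ((0 : Fin 1) : ℕ) ≤ v a) = true ↔ 1 ≤ v a :=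
      fun a => decide_eq_true_iff
    refine ⟨(Operation.tri_iff_of_levels he he).mpr fun a b hab => ?_, funext fun a => ?_⟩
    · have := hv3 a b hab
      omega
    · rw [Bool.eq_iff_iff, Operation.dual_iff_of_levels he hv2, he]

theorem CoreName.exists_retract (c : CoreName) : ∃ (F : MinionHom c.minion c.level.minion)
    (F' : MinionHom c.level.minion c.minion), F'.comp F = MinionHom.id _ := by
  cases c with
  | T => exact exists_retract_minionT
  | A k hk => exact exists_retract_minionA k hk
  | B k hk => exact exists_retract_minionB k hk
  | C k hk => exact exists_retract_minionC k hk
  | D k hk => exact exists_retract_minionD k hk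
  | BInf => exact exists_retract_minionBInf
  | CInf => exact exists_retract_minionCInf
  | DInf => exact exists_retract_minionDInf

/-! ### Maps of levels, cores and inequivalence -/

/-- A map on levels that induces a homomorphism of level minions. -/
structure LevelStructure.IsLevelHom (L L' : LevelStructure) (φ : ℕ → ℕ) : Prop where
  map_zero : φ 0 = 0
  map_add : ∀ i ≤ L.top, φ i + φ (L.top - i) = L'.top
  map_rel : ∀ i ≤ L.top, ∀ j ≤ L.top, L.rel i j → L'.rel (φ i) (φ j)

theorem LevelStructure.IsLevelHom.map_top {L L' : LevelStructure} {φ : ℕ → ℕ}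
    (h : L.IsLevelHom L' φ) : φ L.top = L'.top := by
  have := h.map_add 0 (Nat.zero_le _)
  rwa [h.map_zero, zero_add, Nat.sub_zero] at this

/-- Starting from level 0, each step raises the image by at most one. The bound `t` keeps the
argument below the exceptional pairs of the target. -/
theorem LevelStructure.IsLevelHom.map_le {L L' : LevelStructure} {φ : ℕ → ℕ}
    (h : L.IsLevelHom L' φ) {t : ℕ} (ht : t ≤ L.top) (hL : ∀ i < L.top, L.rel (i + 1) i)
    (hL' : ∀ i j, j < t → L'.rel i j → i ≤ j + 1) : ∀ i ≤ t, φ i ≤ i := by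
  intro i
  induction i with
  | zero => intro _; exact h.map_zero.le
  | succ i ih =>
    intro hi
    have h1 := ih (by omega)
    have h2 := h.map_rel (i + 1) (by omega) i (by omega) (hL i (by omega))
    have := hL' _ _ (by omega) h2
    omega

/-- Descending from `t`, each step lowers the image by at most one, so together with the upper bound
nothing can be skipped. -/
theorem LevelStructure.IsLevelHom.le_map {L : LevelStructure} {φ : ℕ → ℕ}
    (h : L.IsLevelHom L φ) {t : ℕ} (ht : t ≤ L.top) (ht' : t ≤ φ t)
    (hL : ∀ i < t, L.rel (i + 1) i)
    (hL' : ∀ i j, 1 ≤ i → i ≤ t → i ≤ L.top → L.rel i j → i ≤ j + 1)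
    (hφ : ∀ i ≤ t, φ i ≤ i) : ∀ i ≤ t, φ i = i := by
  have key : ∀ d ≤ t, φ (t - d) = t - d := by
    intro d
    induction d with
    | zero => intro _; exact le_antisymm (hφ t le_rfl) ht'
    | succ d ih =>
      intro hd
      have h1 := ih (by omega)
      have h2 := h.map_rel (t - (d + 1) + 1) (by omega) (t - (d + 1)) (by omega)
        (hL _ (by omega))
      rw [show t - (d + 1) + 1 = t - d by omega, h1] at h2
      have h3 := hL' _ _ (by omega) (by omega) (by omega) h2
      have h4 := hφ (t - (d + 1)) (by omega)
      omega
  intro i hi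
  have := key (t - i) (by omega)
  rwa [show t - (t - i) = i by omega] at this

/-- A level endomorphism is forced to be the identity, except that for $\mathcal C_k$ and $\mathcal
C_\infty$ the two middle levels may be exchanged. -/
theorem CoreName.levelHom_involutive (c : CoreName) {φ : ℕ → ℕ}
    (h : c.level.IsLevelHom c.level φ) : ∀ i ≤ c.level.top, φ (φ i) = i := by
  have h0 := h.map_zero
  have hadd := h.map_add
  have hrel := h.map_rel
  have htop := h.map_top
  cases c with
  | T =>
    intro i hi
    change i ≤ 0 at hi
    obtain rfl : i = 0 := by omega
    rw [h0, h0]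
  | A k hk =>
    change ∀ i ≤ 2 * k, φ i + φ (2 * k - i) = 2 * k at hadd
    -- Level $k$ is its own complement. It anchors the descent, since the ascent from 0 is available
    -- only up to $k-1$.
    have hk' : φ k = k := by
      have := hadd k (by omega)
      rw [show 2 * k - k = k by omega] at this
      omega
    have hle : ∀ i ≤ k - 1, φ i ≤ i := h.map_le
      (by change k - 1 ≤ 2 * k; omega) (fun i hi => by left; omega)
      (fun i j hj hij => by
        change i ≤ j + 1 ∨ (i = k + 1 ∧ j + 1 = k) at hij
        omega)
    have heq : ∀ i ≤ k, φ i = i := h.le_map (by change k ≤ 2 * k; omega) hk'.ge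
      (fun i hi => by left; omega)
      (fun i j _ hi _ hij => by
        change i ≤ j + 1 ∨ (i = k + 1 ∧ j + 1 = k) at hij
        omega)
      (fun i hi => by
        rcases Nat.lt_or_ge i k with hlt | hge
        · exact hle i (by omega)
        · obtain rfl : i = k := by omega
          exact hk'.le)
    have heq' : ∀ i ≤ 2 * k, φ i = i := by
      intro i hi
      rcases Nat.lt_or_ge k i with hlt | hge
      · have h1 := hadd i hi
        have h2 := heq (2 * k - i) (by omega)
        omega
      · exact heq i hge
    intro i hi
    rw [heq' i hi, heq' i hi]
  | B k hk =>
    have heq := h.le_map le_rfl htop.ge (fun i hi => le_rfl) (fun i j _ _ _ hij => hij)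
      (h.map_le le_rfl (fun i hi => le_rfl) (fun i j _ hij => hij))
    intro i hi
    rw [heq i hi, heq i hi]
  | D k hk =>
    have heq := h.le_map le_rfl htop.ge (fun i hi => le_rfl) (fun i j _ _ _ hij => hij)
      (h.map_le le_rfl (fun i hi => le_rfl) (fun i j _ hij => hij))
    intro i hi
    rw [heq i hi, heq i hi]
  | C k hk =>
    change ∀ i ≤ 2 * k - 1, φ i + φ (2 * k - 1 - i) = 2 * k - 1 at hadd
    change ∀ i ≤ 2 * k - 1, ∀ j ≤ 2 * k - 1,
      (i ≤ j + 1 ∨ (i = k ∧ j + 2 = k) ∨ (i = k + 1 ∧ j + 1 = k)) →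
      (φ i ≤ φ j + 1 ∨ (φ i = k ∧ φ j + 2 = k) ∨ (φ i = k + 1 ∧ φ j + 1 = k)) at hrel
    have hle : ∀ i ≤ k - 2, φ i ≤ i := h.map_le
      (by change k - 2 ≤ 2 * k - 1; omega) (fun i hi => by left; omega)
      (fun i j hj hij => by
        change i ≤ j + 1 ∨ (i = k ∧ j + 2 = k) ∨ (i = k + 1 ∧ j + 1 = k) at hij
        omega)
    have h1 := hle (k - 2) le_rfl
    have h2 := hadd (k - 2) (by omega)
    have h3 := hadd (k - 1) (by omega)
    rw [show 2 * k - 1 - (k - 2) = k + 1 by omega] at h2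
    rw [show 2 * k - 1 - (k - 1) = k by omega] at h3
    have h4 := hrel (k - 1) (by omega) (k - 2) (by omega) (by omega)
    -- The exceptional pair $(k+1,k-1)$ bounds the image of $k-1$ from below, while the pair
    -- $(k-1,k-2)$ bounds it from above. This pins the middle down to two possibilities.
    have h5 := hrel (k + 1) (by omega) (k - 1) (by omega) (by omega)
    have heq : ∀ i ≤ k - 2, φ i = i := h.le_map (by change k - 2 ≤ 2 * k - 1; omega) (by omega)
      (fun i hi => by left; omega)
      (fun i j _ hi _ hij => by
        change i ≤ j + 1 ∨ (i = k ∧ j + 2 = k) ∨ (i = k + 1 ∧ j + 1 = k) at hij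
        omega) hle
    have heq' : ∀ i, k + 1 ≤ i → i ≤ 2 * k - 1 → φ i = i := by
      intro i hi hi'
      have h1 := hadd i hi'
      have h2 := heq (2 * k - 1 - i) (by omega)
      omega
    have hmid : (φ (k - 1) = k - 1 ∧ φ k = k) ∨ (φ (k - 1) = k ∧ φ k = k - 1) := by omega
    intro i hi
    change i ≤ 2 * k - 1 at hi
    rcases Nat.lt_or_ge i (k - 1) with hlt | hge
    · rw [heq i (by omega), heq i (by omega)]
    · rcases Nat.lt_or_ge k i with hlt | hge'
      · rw [heq' i hlt hi, heq' i hlt hi]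
      · have : i = k - 1 ∨ i = k := by omega
        rcases this with rfl | rfl <;> rcases hmid with ⟨e1, e2⟩ | ⟨e1, e2⟩ <;>
          simp only [e1, e2]
  | BInf =>
    have h1 : φ 1 + φ 1 = 2 := hadd 1 (by decide)
    have h2 : φ 2 = 2 := htop
    have h3 : φ 1 = 1 := by omega
    intro i hi
    change i ≤ 2 at hi
    interval_cases i <;> simp only [h0, h2, h3]
  | CInf =>
    have h1 : φ 1 + φ 2 = 3 := hadd 1 (by decide)
    have h2 : φ 3 = 3 := htop
    have h3 : φ 1 ≤ φ 2 ∨ (φ 1 = 2 ∧ φ 2 = 1) :=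
      hrel 1 (by decide) 2 (by decide) (Or.inl (by decide))
    have h4 : φ 2 ≤ φ 1 ∨ (φ 2 = 2 ∧ φ 1 = 1) :=
      hrel 2 (by decide) 1 (by decide) (Or.inr (by decide))
    have h5 : (φ 1 = 1 ∧ φ 2 = 2) ∨ (φ 1 = 2 ∧ φ 2 = 1) := by omega
    intro i hi
    change i ≤ 3 at hi
    rcases h5 with ⟨e1, e2⟩ | ⟨e1, e2⟩ <;> interval_cases i <;> simp only [h0, h2, e1, e2]
  | DInf =>
    have h2 : φ 1 = 1 := htop
    intro i hi
    change i ≤ 1 at hi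
    interval_cases i <;> simp only [h0, h2]

theorem LevelStructure.exists_isLevelHom {L L' : LevelStructure}
    (ξ : MinionHom L.minion L'.minion) :
    ∃ φ : ℕ → ℕ, L.IsLevelHom L' φ ∧ ∀ (n : ℕ+) (v : L.minion.carrier n) (a : Fin n → Bool),
        (ξ.toFun n v).1 a = φ (v.1 a) :=
  let ⟨φ, h, h0, hadd, hrel⟩ := exists_levelMap ξ
  ⟨φ, ⟨h0, hadd, hrel⟩, h⟩

/-- Conjugating an endomorphism by the retraction gives a level endomorphism, which is an
involution. As $F'F=\mathrm{id}$, the endomorphism itself squares to the identity. -/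
theorem CoreName.isCore (c : CoreName) : c.minion.IsCore := by
  obtain ⟨F, F', hF⟩ := c.exists_retract
  have hF' : ∀ n h, F'.toFun n (F.toFun n h) = h := fun n h =>
    congrFun (congrFun (congrArg MinionHom.toFun hF) n) h
  intro ξ
  obtain ⟨φ, hφ, hφ'⟩ := LevelStructure.exists_isLevelHom (F.comp (ξ.comp F'))
  have hinv := c.levelHom_involutive hφ
  have key : ξ.comp ξ = MinionHom.id c.minion := by
    ext n h
    have h1 : ∀ v : c.level.minion.carrier n,
        (F.comp (ξ.comp F')).toFun n ((F.comp (ξ.comp F')).toFun n v) = v := by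
      intro v
      refine Subtype.ext (funext fun a => ?_)
      have h2 := hφ' n ((F.comp (ξ.comp F')).toFun n v) a
      rw [hφ' n v a, hinv _ (v.2.le_top a)] at h2
      exact h2
    have h3 := congrArg (F'.toFun n) (h1 (F.toFun n h))
    simp only [MinionHom.comp, hF'] at h3
    exact h3
  exact ⟨ξ, key, key⟩

/-! ### Pairwise inequivalence of the listed minions. -/

theorem Minion.HomLE.trans {M : Minion.{u}} {N : Minion.{v}} {K : Minion.{w}}
    (h : M.HomLE N) (h' : N.HomLE K) : M.HomLE K :=
  let ⟨ξ⟩ := h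
  let ⟨ν⟩ := h'
  ⟨ν.comp ξ⟩

theorem CoreName.homLE_level (c : CoreName) : c.minion.HomLE c.level.minion :=
  let ⟨F, _⟩ := c.exists_retract
  ⟨F⟩

theorem CoreName.level_homLE (c : CoreName) : c.level.minion.HomLE c.minion :=
  let ⟨_, F', _⟩ := c.exists_retract
  ⟨F'⟩

/-- There is a map of levels inducing a homomorphism. -/
def CoreName.LevelLE (c d : CoreName) : Prop := ∃ φ, c.level.IsLevelHom d.level φ

theorem CoreName.levelLE_of_homLE {c d : CoreName} (h : c.minion.HomLE d.minion) :
    c.LevelLE d := by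
  obtain ⟨ξ⟩ := c.level_homLE.trans (h.trans d.homLE_level)
  obtain ⟨φ, hφ, -⟩ := LevelStructure.exists_isLevelHom ξ
  exact ⟨φ, hφ⟩

theorem CoreName.LevelLE.top_eq_zero {c d : CoreName} (h : c.LevelLE d)
    (hc : c.level.top = 0) : d.level.top = 0 := by
  obtain ⟨φ, hφ⟩ := h
  have h1 := hφ.map_top
  rwa [hc, hφ.map_zero, eq_comm] at h1

/-- An even top means a level equal to its complement, and level maps respect complements. -/
theorem CoreName.LevelLE.even_top {c d : CoreName} (h : c.LevelLE d)
    (hc : Even c.level.top) : Even d.level.top := by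
  obtain ⟨φ, hφ⟩ := h
  obtain ⟨t, ht⟩ := hc
  have h1 := hφ.map_add t (by omega)
  rw [show c.level.top - t = t by omega] at h1
  exact ⟨_, h1.symm⟩

/-- If one may always step down in the source while only level 0 is related to 0 in the target, then
induction from 0 collapses everything to 0. This separates the finite families from the infinite
ones. -/
theorem CoreName.not_levelLE_of_rigid {c d : CoreName} (hc : ∀ i < c.level.top, c.level.rel (i + 1) i)
    (hd : ∀ i, d.level.rel i 0 → i = 0) (hd' : d.level.top ≠ 0) : ¬ c.LevelLE d := by
  rintro ⟨φ, hφ⟩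
  have key : ∀ i ≤ c.level.top, φ i = 0 := by
    intro i
    induction i with
    | zero => intro _; exact hφ.map_zero
    | succ i ih =>
      intro hi
      have h1 := hφ.map_rel (i + 1) hi i (by omega) (hc i (by omega))
      rw [ih (by omega)] at h1
      exact hd _ h1
  exact hd' (hφ.map_top.symm.trans (key _ le_rfl))

theorem CoreName.not_levelLE_A_A {k l : ℕ} {hk hl} (h : k < l) : ¬ (A k hk).LevelLE (A l hl) := by
  rintro ⟨φ, hφ⟩
  have h1 : φ k + φ (2 * k - k) = 2 * l := hφ.map_add k (by change k ≤ 2 * k; omega)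
  rw [show 2 * k - k = k by omega] at h1
  have := hφ.map_le (t := k) (by change k ≤ 2 * k; omega) (fun i hi => by left; omega)
    (fun i j hj hij => by
      change i ≤ j + 1 ∨ (i = l + 1 ∧ j + 1 = l) at hij
      omega) k le_rfl
  omega

/-- The exceptional drop of the source skips the middle level: the images of $k-1$ and $k+1$ differ
upwards by at most one, so their sum is at most $2k-1<2l$. -/
theorem CoreName.not_levelLE_A_B {k l : ℕ} {hk hl} (h : k ≤ l) : ¬ (A k hk).LevelLE (B l hl) := by
  rintro ⟨φ, hφ⟩
  have h1 : φ (k - 1) + φ (2 * k - (k - 1)) = 2 * l :=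
    hφ.map_add (k - 1) (by change k - 1 ≤ 2 * k; omega)
  rw [show 2 * k - (k - 1) = k + 1 by omega] at h1
  have h2 := hφ.map_le (t := k - 1) (by change k - 1 ≤ 2 * k; omega) (fun i hi => by left; omega)
    (fun i j hj hij => hij) (k - 1) le_rfl
  have h3 : φ (k + 1) ≤ φ (k - 1) + 1 := hφ.map_rel (k + 1) (by change k + 1 ≤ 2 * k; omega)
    (k - 1) (by change k - 1 ≤ 2 * k; omega) (Or.inr (by omega))
  omega

theorem CoreName.not_levelLE_B_A {k l : ℕ} {hk hl} (h : k < l) : ¬ (B k hk).LevelLE (A l hl) := by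
  rintro ⟨φ, hφ⟩
  have h1 : φ k + φ (2 * k - k) = 2 * l := hφ.map_add k (by change k ≤ 2 * k; omega)
  rw [show 2 * k - k = k by omega] at h1
  have := hφ.map_le (t := k) (by change k ≤ 2 * k; omega) (fun i hi => le_rfl)
    (fun i j hj hij => by
      change i ≤ j + 1 ∨ (i = l + 1 ∧ j + 1 = l) at hij
      omega) k le_rfl
  omega

theorem CoreName.not_levelLE_B_B {k l : ℕ} {hk hl} (h : k < l) : ¬ (B k hk).LevelLE (B l hl) := by
  rintro ⟨φ, hφ⟩
  have h1 : φ (2 * k) = 2 * l := hφ.map_top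
  have : φ (2 * k) ≤ 2 * k := hφ.map_le le_rfl (fun i hi => le_rfl) (fun i j hj hij => hij) _ le_rfl
  omega

theorem CoreName.not_levelLE_D_D {k l : ℕ} {hk hl} (h : k < l) : ¬ (D k hk).LevelLE (D l hl) := by
  rintro ⟨φ, hφ⟩
  have h1 : φ (2 * k - 1) = 2 * l - 1 := hφ.map_top
  have : φ (2 * k - 1) ≤ 2 * k - 1 :=
    hφ.map_le le_rfl (fun i hi => le_rfl) (fun i j hj hij => hij) _ le_rfl
  omega

theorem CoreName.not_levelLE_C_of_top {c : CoreName} {k l : ℕ} {hl} (h1k : 1 ≤ k) (h : k < l)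
    (hc : c.level.top = 2 * k - 1)
    (hc' : ∀ i < c.level.top, c.level.rel (i + 1) i) : ¬ c.LevelLE (C l hl) := by
  rintro ⟨φ, hφ⟩
  have h1 : φ (k - 1) + φ (c.level.top - (k - 1)) = 2 * l - 1 := hφ.map_add (k - 1) (by omega)
  rw [show c.level.top - (k - 1) = k by omega] at h1
  have h2 := hφ.map_le (t := k - 1) (by omega) hc'
    (fun i j hj hij => by
      change i ≤ j + 1 ∨ (i = l ∧ j + 2 = l) ∨ (i = l + 1 ∧ j + 1 = l) at hij
      omega) (k - 1) le_rfl
  have h3 := hc' (k - 1) (by omega)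
  rw [show k - 1 + 1 = k by omega] at h3
  have h4 : φ k ≤ φ (k - 1) + 1 ∨ (φ k = l ∧ φ (k - 1) + 2 = l) ∨
    (φ k = l + 1 ∧ φ (k - 1) + 1 = l) := hφ.map_rel k (by omega) (k - 1) (by omega) h3
  omega

/-- The exceptional pair $(k,k-2)$ makes the image of $k$ at most $k-1$, so the images of the two
middle levels sum to at most $2k-2$. -/
theorem CoreName.not_levelLE_C_D {k l : ℕ} {hk hl} (h : k ≤ l) : ¬ (C k hk).LevelLE (D l hl) := by
  rintro ⟨φ, hφ⟩
  have h1 : φ (k - 1) + φ (2 * k - 1 - (k - 1)) = 2 * l - 1 :=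
    hφ.map_add (k - 1) (by change k - 1 ≤ 2 * k - 1; omega)
  rw [show 2 * k - 1 - (k - 1) = k by omega] at h1
  have h2 := hφ.map_le (t := k - 1) (by change k - 1 ≤ 2 * k - 1; omega)
    (fun i hi => by left; omega) (fun i j hj hij => hij)
  have h3 : φ k ≤ φ (k - 2) + 1 := hφ.map_rel k (by change k ≤ 2 * k - 1; omega)
    (k - 2) (by change k - 2 ≤ 2 * k - 1; omega) (Or.inr (by omega))
  have h4 := h2 (k - 1) le_rfl
  have h5 := h2 (k - 2) (by omega)
  omega

theorem CoreName.not_levelLE_CInf_DInf : ¬ CInf.LevelLE DInf := by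
  rintro ⟨φ, hφ⟩
  have h1 : φ 1 + φ 2 = 1 := hφ.map_add 1 (by decide)
  have h3 : φ 1 ≤ φ 2 := hφ.map_rel 1 (by decide) 2 (by decide) (Or.inl (by decide))
  have h4 : φ 2 ≤ φ 1 := hφ.map_rel 2 (by decide) 1 (by decide) (Or.inr (by decide))
  omega

theorem CoreName.A_step (k hk) : ∀ i < (A k hk).level.top, (A k hk).level.rel (i + 1) i :=
  fun _ _ => Or.inl le_rfl

theorem CoreName.B_step (k hk) : ∀ i < (B k hk).level.top, (B k hk).level.rel (i + 1) i :=
  fun _ _ => le_rfl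

theorem CoreName.C_step (k hk) : ∀ i < (C k hk).level.top, (C k hk).level.rel (i + 1) i :=
  fun _ _ => Or.inl le_rfl

theorem CoreName.D_step (k hk) : ∀ i < (D k hk).level.top, (D k hk).level.rel (i + 1) i :=
  fun _ _ => le_rfl

theorem CoreName.not_levelLE_BInf {c : CoreName}
    (hc : ∀ i < c.level.top, c.level.rel (i + 1) i) : ¬ c.LevelLE BInf :=
  not_levelLE_of_rigid hc (fun _ h => Nat.le_zero.mp h) (by decide)

theorem CoreName.not_levelLE_CInf {c : CoreName}
    (hc : ∀ i < c.level.top, c.level.rel (i + 1) i) : ¬ c.LevelLE CInf :=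
  not_levelLE_of_rigid hc (fun i h => by
    change i ≤ 0 ∨ (i = 2 ∧ 0 = 1) at h
    omega) (by decide)

theorem CoreName.not_levelLE_DInf {c : CoreName}
    (hc : ∀ i < c.level.top, c.level.rel (i + 1) i) : ¬ c.LevelLE DInf :=
  not_levelLE_of_rigid hc (fun _ h => Nat.le_zero.mp h) (by decide)

theorem CoreName.eq_of_levelLE_of_even {c d : CoreName} (h : c.LevelLE d) (h' : d.LevelLE c)
    (hc : Even c.level.top) (hd : Even d.level.top) (hc0 : c.level.top ≠ 0)
    (hd0 : d.level.top ≠ 0) : c = d := by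
  cases c with
  | T => exact absurd rfl hc0
  | A k hk =>
    cases d with
    | T => exact absurd rfl hd0
    | A l hl =>
      rcases lt_trichotomy k l with hlt | rfl | hlt
      · exact absurd h (not_levelLE_A_A hlt)
      · rfl
      · exact absurd h' (not_levelLE_A_A hlt)
    | B l hl =>
      rcases Nat.lt_or_ge l k with hlt | hge
      · exact absurd h' (not_levelLE_B_A hlt)
      · exact absurd h (not_levelLE_A_B hge)
    | C l hl =>
      obtain ⟨t, ht⟩ := hd
      change 2 * l - 1 = t + t at ht
      omega
    | D l hl =>
      obtain ⟨t, ht⟩ := hd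
      change 2 * l - 1 = t + t at ht
      omega
    | BInf => exact absurd h (not_levelLE_BInf (A_step k hk))
    | CInf => exact absurd hd (by decide)
    | DInf => exact absurd hd (by decide)
  | B k hk =>
    cases d with
    | T => exact absurd rfl hd0
    | A l hl =>
      rcases Nat.lt_or_ge k l with hlt | hge
      · exact absurd h (not_levelLE_B_A hlt)
      · exact absurd h' (not_levelLE_A_B hge)
    | B l hl =>
      rcases lt_trichotomy k l with hlt | rfl | hlt
      · exact absurd h (not_levelLE_B_B hlt)
      · rfl
      · exact absurd h' (not_levelLE_B_B hlt)
    | C l hl =>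
      obtain ⟨t, ht⟩ := hd
      change 2 * l - 1 = t + t at ht
      omega
    | D l hl =>
      obtain ⟨t, ht⟩ := hd
      change 2 * l - 1 = t + t at ht
      omega
    | BInf => exact absurd h (not_levelLE_BInf (B_step k hk))
    | CInf => exact absurd hd (by decide)
    | DInf => exact absurd hd (by decide)
  | C k hk =>
    obtain ⟨t, ht⟩ := hc
    change 2 * k - 1 = t + t at ht
    omega
  | D k hk =>
    obtain ⟨t, ht⟩ := hc
    change 2 * k - 1 = t + t at ht
    omega
  | BInf =>
    cases d with
    | T => exact absurd rfl hd0
    | A l hl => exact absurd h' (not_levelLE_BInf (A_step l hl))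
    | B l hl => exact absurd h' (not_levelLE_BInf (B_step l hl))
    | C l hl =>
      obtain ⟨t, ht⟩ := hd
      change 2 * l - 1 = t + t at ht
      omega
    | D l hl =>
      obtain ⟨t, ht⟩ := hd
      change 2 * l - 1 = t + t at ht
      omega
    | BInf => rfl
    | CInf => exact absurd hd (by decide)
    | DInf => exact absurd hd (by decide)
  | CInf => exact absurd hc (by decide)
  | DInf => exact absurd hc (by decide)

theorem CoreName.eq_of_levelLE_of_odd {c d : CoreName} (h : c.LevelLE d) (h' : d.LevelLE c)
    (hc : ¬ Even c.level.top) (hd : ¬ Even d.level.top) : c = d := by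
  cases c with
  | T => exact absurd (by decide) hc
  | A k hk => exact absurd (even_two_mul k) hc
  | B k hk => exact absurd (even_two_mul k) hc
  | BInf => exact absurd (by decide) hc
  | C k hk =>
    cases d with
    | T => exact absurd (by decide) hd
    | A l hl => exact absurd (even_two_mul l) hd
    | B l hl => exact absurd (even_two_mul l) hd
    | BInf => exact absurd (by decide) hd
    | C l hl =>
      rcases lt_trichotomy k l with hlt | rfl | hlt
      · exact absurd h (not_levelLE_C_of_top (by omega) hlt rfl (C_step k hk))
      · rfl
      · exact absurd h' (not_levelLE_C_of_top (by omega) hlt rfl (C_step l hl))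
    | D l hl =>
      rcases Nat.lt_or_ge l k with hlt | hge
      · exact absurd h' (not_levelLE_C_of_top hl hlt rfl (D_step l hl))
      · exact absurd h (not_levelLE_C_D hge)
    | CInf => exact absurd h (not_levelLE_CInf (C_step k hk))
    | DInf => exact absurd h (not_levelLE_DInf (C_step k hk))
  | D k hk =>
    cases d with
    | T => exact absurd (by decide) hd
    | A l hl => exact absurd (even_two_mul l) hd
    | B l hl => exact absurd (even_two_mul l) hd
    | BInf => exact absurd (by decide) hd
    | C l hl =>
      rcases Nat.lt_or_ge k l with hlt | hge
      · exact absurd h (not_levelLE_C_of_top hk hlt rfl (D_step k hk))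
      · exact absurd h' (not_levelLE_C_D hge)
    | D l hl =>
      rcases lt_trichotomy k l with hlt | rfl | hlt
      · exact absurd h (not_levelLE_D_D hlt)
      · rfl
      · exact absurd h' (not_levelLE_D_D hlt)
    | CInf => exact absurd h (not_levelLE_CInf (D_step k hk))
    | DInf => exact absurd h (not_levelLE_DInf (D_step k hk))
  | CInf =>
    cases d with
    | T => exact absurd (by decide) hd
    | A l hl => exact absurd (even_two_mul l) hd
    | B l hl => exact absurd (even_two_mul l) hd
    | BInf => exact absurd (by decide) hd
    | C l hl => exact absurd h' (not_levelLE_CInf (C_step l hl))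
    | D l hl => exact absurd h' (not_levelLE_CInf (D_step l hl))
    | CInf => rfl
    | DInf => exact absurd h not_levelLE_CInf_DInf
  | DInf =>
    cases d with
    | T => exact absurd (by decide) hd
    | A l hl => exact absurd (even_two_mul l) hd
    | B l hl => exact absurd (even_two_mul l) hd
    | BInf => exact absurd (by decide) hd
    | C l hl => exact absurd h' (not_levelLE_DInf (C_step l hl))
    | D l hl => exact absurd h' (not_levelLE_DInf (D_step l hl))
    | CInf => exact absurd h' not_levelLE_CInf_DInf
    | DInf => rfl

theorem CoreName.eq_T_of_top_eq_zero {c : CoreName} (h : c.level.top = 0) : c = T := by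
  cases c with
  | T => rfl
  | A k hk => change 2 * k = 0 at h; omega
  | B k hk => change 2 * k = 0 at h; omega
  | C k hk => change 2 * k - 1 = 0 at h; omega
  | D k hk => change 2 * k - 1 = 0 at h; omega
  | BInf => exact absurd h (by decide)
  | CInf => exact absurd h (by decide)
  | DInf => exact absurd h (by decide)

theorem CoreName.eq_of_homLE {c d : CoreName} (h : c.minion.HomLE d.minion)
    (h' : d.minion.HomLE c.minion) : c = d := by
  replace h := levelLE_of_homLE h
  replace h' := levelLE_of_homLE h'
  by_cases hc : Even c.level.top
  · by_cases hc0 : c.level.top = 0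
    · rw [eq_T_of_top_eq_zero hc0, eq_T_of_top_eq_zero (h.top_eq_zero hc0)]
    · exact eq_of_levelLE_of_even h h' hc (h.even_top hc) hc0 fun hd => hc0 (h'.top_eq_zero hd)
  · exact eq_of_levelLE_of_odd h h' hc fun hd => hc (h'.even_top hd)

/-! ### Boolean functionals on a minion -/

/-- A minor-preserving assignment of idempotent Boolean operations to the members of `M`. -/
@[ext]
structure BoolFunctional (M : Minion.{u}) where
  toFun : ∀ n : ℕ+, M.carrier n → Operation Bool n
  map_minor : ∀ {n m : ℕ+} (α : Fin n → Fin m) (f : M.carrier n),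
    toFun m (M.minor α f) = (toFun n f).minor α
  idempotent : ∀ (n : ℕ+) (f : M.carrier n), (toFun n f).IsIdempotent

namespace BoolFunctional

variable {M : Minion.{u}}

/-- Pointwise dual. -/
def dual (F : BoolFunctional M) : BoolFunctional M where
  toFun := fun n f => (F.toFun n f).dual
  map_minor := fun α f => by rw [F.map_minor, Operation.dual_minor]
  idempotent := fun n f b => by
    have := F.idempotent n f (!b)
    simp only [Operation.dual, this, Bool.not_not]

/-- Pointwise meet. -/
def inf (F G : BoolFunctional M) : BoolFunctional M where
  toFun := fun n f => F.toFun n f ⊓ G.toFun n f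
  map_minor := fun α f => by
    rw [F.map_minor, G.map_minor]
    rfl
  idempotent := fun n f b => by
    rw [Pi.inf_apply, F.idempotent, G.idempotent, inf_idem]

/-- The median of `F`, `S` and the dual of `F`, when `F` is below its dual. -/
def median (F S : BoolFunctional M) : BoolFunctional M where
  toFun := fun n f => F.toFun n f ⊔ ((F.toFun n f).dual ⊓ S.toFun n f)
  map_minor := fun α f => by
    rw [F.map_minor, S.map_minor]
    rfl
  idempotent := fun n f b => by
    have h : (F.toFun n f).dual (fun _ => b) = b := F.dual.idempotent n f b
    rw [Pi.sup_apply, Pi.inf_apply, F.idempotent, S.idempotent, h, inf_idem, sup_idem]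

/-- `F ◁ G` for all members of the minion. -/
def Tri (F G : BoolFunctional M) : Prop := ∀ n f, (F.toFun n f).Tri (G.toFun n f)

/-- `F ≤ G` for all members of the minion. -/
def Le (F G : BoolFunctional M) : Prop := ∀ n f, F.toFun n f ≤ G.toFun n f

theorem dual_dual (F : BoolFunctional M) : F.dual.dual = F := by
  ext1
  funext n f
  exact Operation.dual_dual _

theorem Tri.le {F G : BoolFunctional M} (h : F.Tri G) : F.Le G := fun n f => (h n f).le

theorem Tri.dual {F G : BoolFunctional M} (h : F.Tri G) : G.dual.Tri F.dual :=
  fun n f => (h n f).dual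

theorem Tri.trans {F G H : BoolFunctional M} (h : F.Tri G) (h' : G.Tri H) : F.Tri H :=
  fun n f => (h n f).trans (h' n f)

theorem Tri.trans_le {F G H : BoolFunctional M} (h : F.Tri G) (h' : G.Le H) : F.Tri H :=
  fun n f => (h n f).trans_le (h' n f)

theorem Le.trans_tri {F G H : BoolFunctional M} (h : F.Le G) (h' : G.Tri H) : F.Tri H :=
  fun n f a b hab => (h n f a).trans (h' n f a b hab)

theorem Le.trans {F G H : BoolFunctional M} (h : F.Le G) (h' : G.Le H) : F.Le H :=
  fun n f => (h n f).trans (h' n f)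

theorem Le.antisymm {F G : BoolFunctional M} (h : F.Le G) (h' : G.Le F) : F = G := by
  ext1
  funext n f
  exact le_antisymm (h n f) (h' n f)

theorem inf_tri_inf {F F' G G' : BoolFunctional M} (h : F.Tri G) (h' : F'.Tri G') :
    (F.inf F').Tri (G.inf G') := fun n f a b hab => inf_le_inf (h n f a b hab) (h' n f a b hab)

theorem inf_le_left (F G : BoolFunctional M) : (F.inf G).Le F := fun _ _ _ => _root_.inf_le_left

/-- By De Morgan the right-hand side is $F^d\vee G$. -/
theorem le_dual_inf_dual (F G : BoolFunctional M) : G.Le (F.inf G.dual).dual := by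
  intro n f a
  rw [Bool.le_iff_of_imp]
  intro h
  change (!(F.toFun n f _ && !(G.toFun n f _))) = true
  simp [h]

theorem le_median (F S : BoolFunctional M) : F.Le (F.median S) := fun _ _ _ => le_sup_left

theorem median_eq_dual {F S : BoolFunctional M} (hF : F.Le F.dual) (hS : S = S.dual) :
    F.median S = (F.median S).dual := by
  ext1
  funext n f a
  have h1 := hF n f a
  have h2 := hF n f (fun i => !(a i))
  have h3 := congrFun (congrFun (congrFun (congrArg toFun hS) n) f) a
  revert h1 h2 h3
  simp only [median, dual, Operation.dual, Pi.sup_apply, Pi.inf_apply, Bool.not_not]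
  cases F.toFun n f a <;> cases F.toFun n f (fun i => !(a i)) <;> cases S.toFun n f a <;>
    cases S.toFun n f (fun i => !(a i)) <;> simp

/-! ### Homomorphisms to the listed minions from walks of functionals. -/

theorem homLE_boolMinion {k : ℕ} {P : ∀ n : ℕ+, SortedBoolOp k n → Prop}
    {hproj : ∀ (n : ℕ+) (i : Fin n), P n (fun _ => Operation.proj Bool i)}
    {hminor : ∀ (n m : ℕ+) (α : Fin n → Fin m) (h : SortedBoolOp k n), P n h →
      P m (fun s => (h s).minor α)} (F : Fin k → BoolFunctional M)
    (hF : ∀ n f, P n (fun s => (F s).toFun n f)) : M.HomLE (boolMinion k P hproj hminor) :=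
  ⟨⟨fun n f => ⟨fun s => (F s).toFun n f, fun s => (F s).idempotent n f, hF n f⟩,
    fun α f => Subtype.ext (funext fun s => (F s).map_minor α f)⟩⟩

/-- A walk of length `n` for the relation `◁`. -/
def IsWalk (c : ℕ → BoolFunctional M) (n : ℕ) : Prop := ∀ i < n, (c i).Tri (c (i + 1))

/-- The meet of a walk with its reversed dual. -/
def fold (c : ℕ → BoolFunctional M) (n i : ℕ) : BoolFunctional M := (c i).inf (c (n - i)).dual

theorem IsWalk.tri {c : ℕ → BoolFunctional M} {n : ℕ} (h : IsWalk c n) {i j : ℕ} (hij : i < j)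
    (hj : j ≤ n) : (c i).Tri (c j) := by
  obtain ⟨d, rfl⟩ := Nat.exists_eq_add_of_lt hij
  induction d with
  | zero => exact h i (by omega)
  | succ d ih => exact (ih (by omega) (by omega)).trans (h (i + d + 1) (by omega))

theorem IsWalk.fold_tri {c : ℕ → BoolFunctional M} {n : ℕ} (h : IsWalk c n) {i : ℕ} (hi : i < n) :
    (fold c n i).Tri (fold c n (i + 1)) := by
  refine inf_tri_inf (h i hi) ?_
  have := h (n - (i + 1)) (by omega)
  rw [show n - (i + 1) + 1 = n - i by omega] at this
  exact this.dual

/-- Before the midpoint, $c_i\wedge c_{n-i}^d\le c_i\triangleleft c_{n-i}\le (c_i\wedge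
c_{n-i}^d)^d$. At the midpoint itself $c_i=c_{n-i}$, and only $\le$ survives; this is the difference
between $\mathcal B$ and $\mathcal A$. -/
theorem IsWalk.fold_tri_dual {c : ℕ → BoolFunctional M} {n : ℕ} (h : IsWalk c n) {i : ℕ}
    (hi : 2 * i < n) : (fold c n i).Tri (fold c n i).dual :=
  ((inf_le_left _ _).trans_tri (h.tri (by omega) (by omega : n - i ≤ n))).trans_le
    (le_dual_inf_dual _ _)

theorem IsWalk.fold_le_dual {c : ℕ → BoolFunctional M} {n : ℕ} (h : IsWalk c n) {i : ℕ}
    (hi : 2 * i ≤ n) : (fold c n i).Le (fold c n i).dual := by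
  rcases hi.lt_or_eq with hlt | heq
  · exact (h.fold_tri_dual hlt).le
  · refine (inf_le_left _ _).trans ?_
    have := le_dual_inf_dual (c i) (c (n - i))
    unfold fold
    rwa [show n - i = i by omega] at this ⊢

theorem IsWalk.homLE_B {c : ℕ → BoolFunctional M} {k : ℕ} (h : IsWalk c (2 * k - 1)) :
    M.HomLE (minionB k) := by
  refine homLE_boolMinion (fun s : Fin k => fold c (2 * k - 1) s) fun n f =>
    ⟨fun i j hij => ?_, fun i hi => ?_⟩
  · have := j.2
    dsimp only
    rw [← hij]
    exact h.fold_tri (by omega) n f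
  · exact h.fold_tri_dual (by omega) n f

theorem IsWalk.homLE_A {c : ℕ → BoolFunctional M} {k : ℕ} (h : IsWalk c (2 * k - 2)) :
    M.HomLE (minionA k) := by
  refine homLE_boolMinion (fun s : Fin k => fold c (2 * k - 2) s) fun n f =>
    ⟨fun i j hij => ?_, fun i hi => ?_⟩
  · have := j.2
    dsimp only
    rw [← hij]
    exact h.fold_tri (by omega) n f
  · exact h.fold_le_dual (by omega) n f

/-- The folded midpoint is below its dual; its median with the self-dual `S` makes it self-dual
without making it smaller. -/
theorem IsWalk.homLE_D {c : ℕ → BoolFunctional M} {k : ℕ} (h : IsWalk c (2 * k - 2))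
    {S : BoolFunctional M} (hS : S = S.dual) : M.HomLE (minionD k) := by
  refine homLE_boolMinion (fun s : Fin k => if (s : ℕ) + 1 < k then fold c (2 * k - 2) s else
    (fold c (2 * k - 2) s).median S) fun n f => ⟨fun i j hij => ?_, fun i hi => ?_⟩
  · have hj := j.2
    have h1 : (i : ℕ) + 1 < k := by omega
    simp only [if_pos h1]
    by_cases h2 : (j : ℕ) + 1 < k
    · rw [if_pos h2, ← hij]
      exact h.fold_tri (by omega) n f
    · rw [if_neg h2, ← hij]
      exact (h.fold_tri (by omega)).trans_le (le_median _ _) n f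
  · have h1 : ¬ (i : ℕ) + 1 < k := by omega
    simp only [if_neg h1]
    exact congrFun (congrFun (congrArg toFun
      (median_eq_dual (h.fold_le_dual (by omega)) hS)) n) f

/-- There is no midpoint here, so the folds supply only $k-1$ operations. The median of the last one
with `S` is added as $h_k$. -/
theorem IsWalk.homLE_C {c : ℕ → BoolFunctional M} {k : ℕ} (hk : 2 ≤ k) (h : IsWalk c (2 * k - 3))
    {S : BoolFunctional M} (hS : S = S.dual) : M.HomLE (minionC k) := by
  refine homLE_boolMinion (fun s : Fin k => if (s : ℕ) + 1 < k then fold c (2 * k - 3) s else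
    (fold c (2 * k - 3) (k - 2)).median S) fun n f =>
      ⟨fun i j hij hj => ?_, fun i j hij hj => ?_, fun i hi => ?_, fun i hi => ?_⟩
  · have h1 : (i : ℕ) + 1 < k := by omega
    simp only [if_pos h1, if_pos hj]
    rw [← hij]
    exact h.fold_tri (by omega) n f
  · have h1 : (i : ℕ) + 1 < k := by omega
    have h2 : ¬ (j : ℕ) + 1 < k := by omega
    simp only [if_pos h1, if_neg h2]
    rw [show (i : ℕ) = k - 2 by omega]
    exact le_median _ _ n f
  · have h1 : ¬ (i : ℕ) + 1 < k := by omega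
    simp only [if_neg h1]
    exact congrFun (congrFun (congrArg toFun
      (median_eq_dual (h.fold_le_dual (by omega)) hS)) n) f
  · have h1 : (i : ℕ) + 1 < k := by omega
    simp only [if_pos h1]
    exact h.fold_tri_dual (by omega) n f

theorem inf_dual_tri_dual {F : BoolFunctional M} (h : F.Tri F) :
    (F.inf F.dual).Tri (F.inf F.dual).dual :=
  ((inf_le_left _ _).trans_tri h).trans_le (le_dual_inf_dual _ _)

theorem homLE_BInf {F : BoolFunctional M} (h : F.Tri F) : M.HomLE minionBInf :=
  homLE_boolMinion (fun _ => F.inf F.dual) fun n f =>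
    ⟨inf_tri_inf h h.dual n f, inf_dual_tri_dual h n f⟩

theorem homLE_CInf {F : BoolFunctional M} (h : F.Tri F) {S : BoolFunctional M}
    (hS : S = S.dual) : M.HomLE minionCInf :=
  homLE_boolMinion ![F.inf F.dual, (F.inf F.dual).median S] fun n f =>
    ⟨inf_tri_inf h h.dual n f, (inf_tri_inf h h.dual).trans_le (le_median _ _) n f,
      congrFun (congrFun (congrArg toFun
        (median_eq_dual (inf_dual_tri_dual h).le hS)) n) f⟩

theorem homLE_DInf {F : BoolFunctional M} (h : F.Tri F.dual) (h' : F.dual.Tri F) :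
    M.HomLE minionDInf :=
  homLE_boolMinion (fun _ => F) fun n f =>
    ⟨h.trans h' n f, congrFun (congrFun (congrArg toFun (h.le.antisymm h'.le)) n) f⟩

end BoolFunctional

/-! ### Homomorphisms from level minions to polymorphism minions -/

open Classical in
/-- The function on sets of elements determined by a level map and a tuple. -/
noncomputable def setLevel {A : Type u} {n : ℕ} (v : (Fin n → Bool) → ℕ) (a : Fin n → A)
    (Y : Set A) : ℕ := v (fun i => decide (a i ∈ Y))

/-- `u Y` depends only on the membership of `x` and `y` in `Y`. -/
def DependsOnPair {A : Type u} (u : Set A → ℕ) (x y : A) : Prop :=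
  ∀ Y Y' : Set A, (x ∈ Y ↔ x ∈ Y') → (y ∈ Y ↔ y ∈ Y') → u Y = u Y'

open Classical in
/-- The element of the pair selected by the threshold `τ`. -/
noncomputable def pairValue {A : Type u} (τ : A → A → ℕ) (u : Set A → ℕ) (x y : A) : A :=
  if τ x y ≤ u {y} then y else x

open Classical in
/-- The element selected by the thresholds `τ`. -/
noncomputable def thresholdValue {A : Type u} [Nonempty A] (τ : A → A → ℕ) (u : Set A → ℕ) : A :=
  if h : ∃ p : A × A, p.1 ≠ p.2 ∧ DependsOnPair u p.1 p.2 then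
    pairValue τ u h.choose.1 h.choose.2
  else Classical.arbitrary A

/-- Thresholds for ordered pairs, compatible with the exchange of the two elements. -/
def IsThreshold {A : Type u} (m : ℕ) (τ : A → A → ℕ) : Prop :=
  ∀ x y, x ≠ y → 1 ≤ τ x y ∧ τ x y ≤ m ∧ τ x y + τ y x = m + 1

/-- The set function does not remember the tuple, so several pairs may carry it. Exchanged pairs
agree since their thresholds sum to $m+1$. If exactly one element is common, its singleton has full
level whenever it is compared with the other pair, or the unshared elements have level 0, so the
common element is selected. Disjoint pairs would force $0=m$. -/
theorem pairValue_eq {A : Type u} {m : ℕ} (hm : 1 ≤ m) {τ : A → A → ℕ} (hτ : IsThreshold m τ)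
    {u : Set A → ℕ} (h0 : u ∅ = 0) (hu : ∀ Y, u Y + u Yᶜ = m) {x y x' y' : A} (hxy : x ≠ y)
    (hxy' : x' ≠ y') (h : DependsOnPair u x y) (h' : DependsOnPair u x' y') :
    pairValue τ u x y = pairValue τ u x' y' := by
  have h1 : u Set.univ = m := by
    have := hu ∅
    rwa [h0, zero_add, Set.compl_empty] at this
  have out : ∀ z, z ≠ x → z ≠ y → u {z} = 0 := fun z hx hy => by
    rw [← h0]
    exact h _ _ (by simp [hx.symm]) (by simp [hy.symm])
  have out' : ∀ z, z ≠ x' → z ≠ y' → u {z} = 0 := fun z hx hy => by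
    rw [← h0]
    exact h' _ _ (by simp [hx.symm]) (by simp [hy.symm])
  have both : ∀ {z}, (z = x ∧ y ≠ x' ∧ y ≠ y') ∨ (z = y ∧ x ≠ x' ∧ x ≠ y') →
      (z = x' ∨ z = y') → u {z} = m := by
    rintro z (⟨rfl, h2, h3⟩ | ⟨rfl, h2, h3⟩) _
    · rw [← h1, h' {z} {z, y} (by simp [h2.symm]) (by simp [h3.symm])]
      exact h _ _ (by simp) (by simp)
    · rw [← h1, h' {z} {z, x} (by simp [h2.symm]) (by simp [h3.symm])]
      exact h _ _ (by simp) (by simp)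
  obtain ⟨t1, t2, t3⟩ := hτ x y hxy
  obtain ⟨t1', t2', t3'⟩ := hτ x' y' hxy'
  by_cases hxx : x = x'
  · by_cases hyy : y = y'
    · rw [hxx, hyy]
    · have e1 : u {y} = 0 := out' y (by rw [← hxx]; exact hxy.symm) hyy
      have e2 : u {y'} = 0 := out y' (by rw [hxx]; exact hxy'.symm) (Ne.symm hyy)
      rw [pairValue, pairValue, if_neg (by omega), if_neg (by omega), hxx]
  · by_cases hxy2 : x = y'
    · by_cases hyx : y = x'
      · subst hxy2 hyx
        have e : u {x} = u {y}ᶜ := h _ _ (by simp [hxy]) (by simp [hxy.symm])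
        have := hu {y}
        by_cases hc : τ x y ≤ u {y}
        · rw [pairValue, pairValue, if_pos hc, if_neg (by omega)]
        · rw [pairValue, pairValue, if_neg hc, if_pos (by omega)]
      · have e1 : u {y} = 0 := out' y hyx (by rw [← hxy2]; exact hxy.symm)
        have e2 : u {y'} = m := by
          rw [← hxy2]
          exact both (Or.inl ⟨rfl, hyx, by rw [← hxy2]; exact hxy.symm⟩) (Or.inr hxy2)
        rw [pairValue, pairValue, if_neg (by omega), if_pos (by omega), hxy2]
    · have hm' : ∀ z, z = y → z = x' ∨ z = y' → u {z} = m :=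
        fun z hz hz' => both (Or.inr ⟨hz, hxx, hxy2⟩) hz'
      by_cases hyx : y = x'
      · have e1 : u {y} = m := hm' y rfl (Or.inl hyx)
        have e2 : u {y'} = 0 := out y' (Ne.symm hxy2) (by rw [hyx]; exact hxy'.symm)
        rw [pairValue, pairValue, if_pos (by omega), if_neg (by omega), hyx]
      · by_cases hyy : y = y'
        · have e1 : u {y} = m := hm' y rfl (Or.inr hyy)
          have e2 : u {y'} = m := by rw [← hyy]; exact e1
          rw [pairValue, pairValue, if_pos (by omega), if_pos (by omega), hyy]
        · have e1 : u {x', y'} = u ∅ := h _ _ (by simp [hxx, hxy2]) (by simp [hyx, hyy])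
          have e2 : u {x', y'} = u Set.univ := h' _ _ (by simp) (by simp)
          omega

theorem thresholdValue_eq {A : Type u} [Nonempty A] {m : ℕ} (hm : 1 ≤ m) {τ : A → A → ℕ}
    (hτ : IsThreshold m τ) {u : Set A → ℕ} (h0 : u ∅ = 0) (hu : ∀ Y, u Y + u Yᶜ = m) {x y : A}
    (hxy : x ≠ y) (h : DependsOnPair u x y) : thresholdValue τ u = pairValue τ u x y := by
  have hex : ∃ p : A × A, p.1 ≠ p.2 ∧ DependsOnPair u p.1 p.2 := ⟨(x, y), hxy, h⟩
  rw [thresholdValue, dif_pos hex]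
  exact pairValue_eq hm hτ h0 hu hex.choose_spec.1 hxy hex.choose_spec.2 h

section Threshold

variable {A : Type u} [Nonempty A] {L : LevelStructure} {τ : A → A → ℕ} {n : ℕ+}
  {v : (Fin n → Bool) → ℕ} {a : Fin n → A}

theorem thresholdValue_setLevel (hm : 1 ≤ L.top) (hτ : IsThreshold L.top τ) (hv : L.IsLevelMap v)
    {x y : A} (hxy : x ≠ y) (ha : ∀ i, a i = x ∨ a i = y) :
    thresholdValue τ (setLevel v a) = pairValue τ (setLevel v a) x y := by
  classical
  refine thresholdValue_eq hm hτ ?_ ?_ hxy ?_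
  · simpa [setLevel] using hv.1
  · intro Y
    have := hv.2.1 (fun i => decide (a i ∈ Y))
    simpa [setLevel] using this
  · intro Y Y' hx hy
    refine congrArg v (funext fun i => ?_)
    rcases ha i with h | h <;> simp [h, hx, hy]

theorem thresholdValue_const (hm : 1 ≤ L.top) (hτ : IsThreshold L.top τ) (hv : L.IsLevelMap v)
    {x : A} (ha : ∀ i, a i = x) : thresholdValue τ (setLevel v a) = x := by
  classical
  by_cases hx : ∃ y, x ≠ y
  · obtain ⟨y, hxy⟩ := hx
    rw [thresholdValue_setLevel hm hτ hv hxy fun i => Or.inl (ha i), pairValue, if_neg]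
    have : setLevel v a {y} = 0 := by
      have h0 := hv.1
      simpa [setLevel, ha, hxy] using h0
    have := (hτ x y hxy).1
    omega
  · by_contra hne
    exact hx ⟨_, Ne.symm hne⟩

theorem thresholdValue_mem_range (hm : 1 ≤ L.top) (hτ : IsThreshold L.top τ)
    (hv : L.IsLevelMap v) {x y : A} (ha : ∀ i, a i = x ∨ a i = y) :
    ∃ i, thresholdValue τ (setLevel v a) = a i := by
  classical
  let i0 : Fin n := ⟨0, n.pos⟩
  by_cases hx : ∀ i, a i = x
  · exact ⟨i0, (thresholdValue_const hm hτ hv hx).trans (hx i0).symm⟩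
  by_cases hy : ∀ i, a i = y
  · exact ⟨i0, (thresholdValue_const hm hτ hv hy).trans (hy i0).symm⟩
  push Not at hx hy
  obtain ⟨i, hi⟩ := hx
  obtain ⟨j, hj⟩ := hy
  have hi' := (ha i).resolve_left hi
  have hj' := (ha j).resolve_right hj
  have hxy : x ≠ y := by
    rintro rfl
    exact hi hi'
  rw [thresholdValue_setLevel hm hτ hv hxy ha, pairValue]
  split_ifs
  · exact ⟨i, hi'.symm⟩
  · exact ⟨j, hj'.symm⟩

end Threshold

theorem exists_pair_of_encard_le_two {A : Type u} {S : Set A} (hS : S.encard ≤ 2) {n : ℕ+}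
    {a : Fin n → A} (ha : ∀ i, a i ∈ S) : ∃ x y, ∀ i, a i = x ∨ a i = y := by
  by_contra hne
  push Not at hne
  let i0 : Fin n := ⟨0, n.pos⟩
  obtain ⟨i1, h1, -⟩ := hne (a i0) (a i0)
  obtain ⟨i2, h2, h3⟩ := hne (a i0) (a i1)
  have hsub : ({a i0, a i1, a i2} : Set A) ⊆ S := by
    rintro z (rfl | rfl | rfl) <;> exact ha _
  have h3 : ({a i0, a i1, a i2} : Set A).encard = 3 :=
    Set.encard_eq_three.mpr ⟨_, _, _, h1.symm, h2.symm, h3.symm, rfl⟩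
  have := (Set.encard_le_encard hsub).trans hS
  rw [h3] at this
  exact absurd this (by decide)

/-- `(x, y)` is in the projection of `R` to the coordinates `p`, `q`. -/
def FinitaryRel.HasPair {A : Type u} (R : FinitaryRel A) (p q : Fin R.arity) (x y : A) : Prop :=
  ∃ t ∈ R.tuples, t p = x ∧ t q = y

/-- The thresholds `τ` are compatible with the implications expressed by `R`. -/
def FinitaryRel.IsCompatible {A : Type u} (R : FinitaryRel A) (L : LevelStructure)
    (τ : A → A → ℕ) : Prop :=
  ∀ (p q : Fin R.arity) (x y z w : A), x ≠ y → z ≠ w → R.HasPair p q x z → R.HasPair p q y w →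
    ¬ R.HasPair p q y z →
      (R.HasPair p q x w → ∀ i ≤ L.top, ∀ j ≤ L.top, L.rel i j → τ x y ≤ i → τ z w ≤ j) ∧
      (¬ R.HasPair p q x w → τ x y = τ z w)

theorem thresholdValue_preserves {A : Type u} [Nonempty A] {L : LevelStructure}
    {τ : A → A → ℕ} (hm : 1 ≤ L.top) (hτ : IsThreshold L.top τ) {R : FinitaryRel A}
    (harity : (R.arity : ℕ) ≤ 2) (hR : R.HasSmallProjections) (hc : R.IsCompatible L τ)
    {n : ℕ+} {v : (Fin n → Bool) → ℕ} (hv : L.IsLevelMap v) :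
    Operation.Preserves (fun a : Fin n → A => thresholdValue τ (setLevel v a)) R := by
  classical
  intro r hr
  have hcol : ∀ j, ∃ x y, ∀ i, r i j = x ∨ r i j = y := fun j =>
    exists_pair_of_encard_le_two (hR j) fun i => ⟨r i, hr i, rfl⟩
  have key : ∀ p q : Fin R.arity, R.HasPair p q (thresholdValue τ (setLevel v fun i => r i p))
      (thresholdValue τ (setLevel v fun i => r i q)) := by
    intro p q
    obtain ⟨x₁, x₂, hx⟩ := hcol p
    obtain ⟨z₁, z₂, hz⟩ := hcol q
    obtain ⟨ip, hip⟩ := thresholdValue_mem_range hm hτ hv hx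
    obtain ⟨iq, hiq⟩ := thresholdValue_mem_range hm hτ hv hz
    rw [hip, hiq]
    by_cases hp : ∀ i, r i p = r ip p
    · exact ⟨r iq, hr iq, hp iq, rfl⟩
    by_cases hq : ∀ i, r i q = r iq q
    · exact ⟨r ip, hr ip, rfl, hq ip⟩
    push Not at hp hq
    obtain ⟨jp, hjp⟩ := hp
    obtain ⟨jq, hjq⟩ := hq
    have hx' : ∀ i, r i p = r jp p ∨ r i p = r ip p := by
      intro i
      rcases hx i with h1 | h1 <;> rcases hx ip with h2 | h2 <;> rcases hx jp with h3 | h3 <;>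
        simp_all
    have hz' : ∀ i, r i q = r iq q ∨ r i q = r jq q := by
      intro i
      rcases hz i with h1 | h1 <;> rcases hz iq with h2 | h2 <;> rcases hz jq with h3 | h3 <;>
        simp_all
    -- Name the columns' values so that the output is $(y,z)$ and suppose that it is missing. Then
    -- every row with $y$ at `p` has $w$ at `q`. The output $y$ says that its threshold is reached,
    -- the output $z$ that the other one is not, against compatibility.
    by_contra hno
    have hyw : ∀ i, r i p = r ip p → r i q = r jq q := fun i hi =>
      (hz' i).resolve_left fun h => hno ⟨r i, hr i, hi, h⟩
    have hxz : ∀ i, r i q = r iq q → r i p = r jp p := fun i hi =>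
      (hx' i).resolve_right fun h => hno ⟨r i, hr i, h, hi⟩
    obtain ⟨c1, c2⟩ := hc p q (r jp p) (r ip p) (r iq q) (r jq q) hjp (Ne.symm hjq)
      ⟨r iq, hr iq, hxz iq rfl, rfl⟩ ⟨r ip, hr ip, rfl, hyw ip rfl⟩ hno
    rw [thresholdValue_setLevel hm hτ hv hjp hx', pairValue] at hip
    rw [thresholdValue_setLevel hm hτ hv (Ne.symm hjq) hz', pairValue] at hiq
    have e1 : τ (r jp p) (r ip p) ≤ setLevel v (fun i => r i p) {r ip p} := by
      by_contra h
      rw [if_neg h] at hip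
      exact hjp hip
    have e2 : ¬ τ (r iq q) (r jq q) ≤ setLevel v (fun i => r i q) {r jq q} := by
      intro h
      rw [if_pos h] at hiq
      exact hjq hiq
    by_cases hxw : R.HasPair p q (r jp p) (r jq q)
    · refine e2 (c1 hxw _ (hv.le_top _) _ (hv.le_top _) (hv.2.2 _ _ fun i => ?_) e1)
      rw [Bool.le_iff_of_imp, decide_eq_true_iff, decide_eq_true_iff]
      exact fun h => hyw i h
    · rw [← c2 hxw] at e2
      refine e2 (e1.trans (le_of_eq (congrArg v (funext fun i => ?_))))
      rw [Bool.eq_iff_iff, decide_eq_true_iff, decide_eq_true_iff]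
      refine ⟨hyw i, fun h => ?_⟩
      exact (hx' i).resolve_left fun h' => hxw ⟨r i, hr i, h', h⟩
  have hpos := R.arity.pos
  -- As the arity is one or two, the first and last coordinates exhaust the tuple.
  obtain ⟨t, ht, h1, h2⟩ := key ⟨0, hpos⟩ ⟨(R.arity : ℕ) - 1, by omega⟩
  convert ht using 1
  funext j
  have hj := j.2
  by_cases h : (j : ℕ) = 0
  · rw [show j = ⟨0, hpos⟩ from Fin.ext h]
    exact h1.symm
  · rw [show j = ⟨(R.arity : ℕ) - 1, by omega⟩ from Fin.ext (by simp only; omega)]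
    exact h2.symm

theorem LevelStructure.homLE_Pol {A : Type u} [Nonempty A] {L : LevelStructure}
    {τ : A → A → ℕ} (hm : 1 ≤ L.top) (hτ : IsThreshold L.top τ) {Ψ : Set (FinitaryRel A)}
    (hΨ : ∀ R ∈ Ψ, (R.arity : ℕ) ≤ 2 ∧ R.HasSmallProjections)
    (hc : ∀ R ∈ Ψ, R.IsCompatible L τ) : L.minion.HomLE (Pol Ψ) :=
  ⟨⟨fun _ v => ⟨fun a => thresholdValue τ (setLevel v.1 a), fun R hR =>
    thresholdValue_preserves hm hτ (hΨ R hR).1 (hΨ R hR).2 (hc R hR) v.2⟩, fun _ _ => rfl⟩⟩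

/-! ### Gradings of finite relations with an involution -/

/-- A transitive relation on a set with an involution that reverses the relation. -/
structure InvRel (V : Type u) where
  inv : V → V
  rel : V → V → Prop
  inv_inv : ∀ p, inv (inv p) = p
  trans : ∀ p q r, rel p q → rel q r → rel p r
  rel_inv : ∀ p q, rel p q → rel (inv q) (inv p)

namespace InvRel

variable {V : Type u} (E : InvRel V)

/-- `τ` turns members of `V` into thresholds for the levels of `L`. -/
def IsGrading (L : LevelStructure) (τ : V → ℕ) : Prop :=
  (∀ p, 1 ≤ τ p ∧ τ p ≤ L.top ∧ τ p + τ (E.inv p) = L.top + 1) ∧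
    ∀ p q, E.rel p q → ∀ i ≤ L.top, ∀ j ≤ L.top, L.rel i j → τ p ≤ i → τ q ≤ j

/-- A maximal up-closed set without complementary members works: if it misses both $p$ and its dual,
then adjoining the up-set of one of them must fail, which by maximality forces both $p\to p^d$ and
$p^d\to p$. -/
theorem exists_upset [Finite V] (hbad : ∀ p, ¬ (E.rel p (E.inv p) ∧ E.rel (E.inv p) p)) :
    ∃ U : Set V, (∀ p q, p ∈ U → E.rel p q → q ∈ U) ∧ (∀ p ∈ U, E.inv p ∉ U) ∧
      ∀ p, E.inv p ≠ p → p ∈ U ∨ E.inv p ∈ U := by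
  let C : Set (Set V) := {U | (∀ p q, p ∈ U → E.rel p q → q ∈ U) ∧ ∀ p ∈ U, E.inv p ∉ U}
  obtain ⟨U, hU⟩ := (Set.toFinite C).exists_maximal ⟨∅, by simp [C]⟩
  have hrel' : ∀ p q, E.rel p (E.inv q) → E.rel q (E.inv p) := fun p q h => by
    have := E.rel_inv _ _ h
    rwa [E.inv_inv] at this
  have extend : ∀ p, E.inv p ≠ p → E.inv p ∉ U → ¬ E.rel p (E.inv p) → p ∈ U := by
    intro p hp hpU hpE
    have hmem : U ∪ {q | q = p ∨ E.rel p q} ∈ C := by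
      refine ⟨?_, ?_⟩
      · rintro q r (hq | rfl | hq) hqr
        · exact Or.inl (hU.prop.1 q r hq hqr)
        · exact Or.inr (Or.inr hqr)
        · exact Or.inr (Or.inr (E.trans _ _ _ hq hqr))
      · rintro q (hq | rfl | hq) (hq' | hq' | hq')
        · exact hU.prop.2 q hq hq'
        · rw [← hq', E.inv_inv] at hpU
          exact hpU hq
        · exact hpU (hU.prop.1 q _ hq (hrel' _ _ hq'))
        · exact hpU hq'
        · exact hp hq'
        · exact hpE hq'
        · exact hpU (hU.prop.1 _ _ hq' (E.rel_inv _ _ hq))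
        · have hqp : q = E.inv p := by rw [← hq', E.inv_inv]
          rw [hqp] at hq
          exact hpE hq
        · exact hpE (E.trans _ _ _ hq (hrel' _ _ hq'))
    exact hU.le_of_ge hmem Set.subset_union_left (Or.inr (Or.inl rfl))
  refine ⟨U, hU.prop.1, hU.prop.2, fun p hp => ?_⟩
  by_contra hno
  push Not at hno
  have h1 : E.rel p (E.inv p) := by
    by_contra h
    exact hno.1 (extend p hp hno.2 h)
  have h2 : E.rel (E.inv p) p := by
    by_contra h
    refine hno.2 (extend (E.inv p) ?_ ?_ ?_)
    · rw [E.inv_inv]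
      exact hp.symm
    · rw [E.inv_inv]
      exact hno.1
    · rwa [E.inv_inv]
  exact hbad p ⟨h1, h2⟩

/-- A walk of length `n`. -/
def IsWalk (c : ℕ → V) (n : ℕ) : Prop := ∀ i < n, E.rel (c i) (c (i + 1))

variable {E}

theorem IsWalk.rel_of_lt {c : ℕ → V} {n : ℕ} (h : E.IsWalk c n) {i j : ℕ} (hij : i < j)
    (hj : j ≤ n) : E.rel (c i) (c j) := by
  obtain ⟨d, rfl⟩ := Nat.exists_eq_add_of_lt hij
  induction d with
  | zero => exact h i (by omega)
  | succ d ih => exact E.trans _ _ _ (ih (by omega) (by omega)) (h (i + d + 1) (by omega))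

theorem IsWalk.lt_card [Finite V] (hirr : ∀ p, ¬ E.rel p p) {c : ℕ → V} {n : ℕ}
    (h : E.IsWalk c n) : n < Nat.card V := by
  have hinj : Function.Injective (fun i : Fin (n + 1) => c i) := by
    intro i j hij
    by_contra hne
    rcases Nat.lt_or_gt_of_ne (fun h => hne (Fin.ext h)) with hlt | hgt
    · have := h.rel_of_lt hlt (by omega)
      rw [show c i = c j from hij] at this
      exact hirr _ this
    · have := h.rel_of_lt hgt (by omega)
      rw [show c i = c j from hij] at this
      exact hirr _ this
  have := Nat.card_le_card_of_injective _ hinj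
  rw [Nat.card_fin] at this
  omega

theorem IsWalk.append {c d : ℕ → V} {a b : ℕ} (hc : E.IsWalk c a) (hd : E.IsWalk d b)
    (h : c a = d 0) : ∃ e, E.IsWalk e (a + b) := by
  refine ⟨fun i => if i ≤ a then c i else d (i - a), fun i hi => ?_⟩
  dsimp only
  rcases lt_trichotomy i a with hlt | rfl | hgt
  · rw [if_pos (by omega), if_pos (by omega)]
    exact hc i hlt
  · rw [if_pos le_rfl, if_neg (by omega), h, show i + 1 - i = 0 + 1 by omega]
    exact hd 0 (by omega)
  · rw [if_neg (by omega), if_neg (by omega), show i + 1 - a = i - a + 1 by omega]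
    exact hd (i - a) (by omega)

theorem IsWalk.snoc {c : ℕ → V} {a : ℕ} (hc : E.IsWalk c a) {q : V} (h : E.rel (c a) q) :
    ∃ e, E.IsWalk e (a + 1) ∧ e (a + 1) = q := by
  refine ⟨fun i => if i ≤ a then c i else q, fun i hi => ?_, by simp⟩
  dsimp only
  rcases (Nat.lt_succ_iff.mp hi).lt_or_eq with hlt | rfl
  · rw [if_pos (by omega), if_pos (by omega)]
    exact hc i hlt
  · rw [if_pos le_rfl, if_neg (by omega)]
    exact h

theorem IsWalk.reverse {c : ℕ → V} {a : ℕ} (hc : E.IsWalk c a) :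
    E.IsWalk (fun i => E.inv (c (a - i))) a := by
  intro i hi
  have := hc (a - (i + 1)) (by omega)
  rw [show a - (i + 1) + 1 = a - i by omega] at this
  exact E.rel_inv _ _ this

variable (E) in
/-- `α` is strictly increasing along walks, which are bounded in terms of `N`. -/
structure IsHeight (N : ℕ) (α : V → ℕ) : Prop where
  add_one_le : ∀ p q, E.rel p q → α p + 1 ≤ α q
  add_inv_le : ∀ p, α p + α (E.inv p) ≤ N
  add_one_add_inv_le : ∀ p q, E.rel p q → α p + 1 + α (E.inv q) ≤ N

/-- Without loops, transitivity forbids repeated vertices, so walks are bounded. Here $\alpha(p)$ is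
the length of a longest walk ending at $p$ and $N$ that of a longest walk. A walk to $p^d$, reversed
and dualized, starts at $p$, whence $\alpha(p)+\alpha(p^d)\le N$. -/
theorem exists_height [Finite V] [Nonempty V] (hirr : ∀ p, ¬ E.rel p p) :
    ∃ (N : ℕ) (α : V → ℕ), (∃ c, E.IsWalk c N) ∧ E.IsHeight N α := by
  classical
  let P : ℕ → Prop := fun n => ∃ c, E.IsWalk c n
  let Q : V → ℕ → Prop := fun p n => ∃ c, E.IsWalk c n ∧ c n = p
  have hN : P (Nat.findGreatest P (Nat.card V)) :=
    Nat.findGreatest_spec (Nat.zero_le _) ⟨fun _ => Classical.arbitrary V, fun i hi => by omega⟩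
  have hN' : ∀ n, P n → n ≤ Nat.findGreatest P (Nat.card V) := fun n hn => by
    obtain ⟨c, hc⟩ := hn
    exact Nat.le_findGreatest (hc.lt_card hirr).le ⟨c, hc⟩
  have hα : ∀ p, Q p (Nat.findGreatest (Q p) (Nat.card V)) := fun p =>
    Nat.findGreatest_spec (Nat.zero_le _) ⟨fun _ => p, fun i hi => by omega, rfl⟩
  have hα' : ∀ p n, Q p n → n ≤ Nat.findGreatest (Q p) (Nat.card V) := fun p n hn => by
    obtain ⟨c, hc, hp⟩ := hn
    exact Nat.le_findGreatest (hc.lt_card hirr).le ⟨c, hc, hp⟩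
  refine ⟨_, fun p => Nat.findGreatest (Q p) (Nat.card V), hN, ⟨fun p q hpq => ?_, fun p => ?_,
    fun p q hpq => ?_⟩⟩
  · obtain ⟨c, hc, hp⟩ := hα p
    rw [← hp] at hpq
    exact hα' q _ (hc.snoc hpq)
  · obtain ⟨c, hc, hp⟩ := hα p
    obtain ⟨d, hd, hp'⟩ := hα (E.inv p)
    exact hN' _ (hc.append hd.reverse (by rw [hp, Nat.sub_zero, hp', E.inv_inv]))
  · obtain ⟨c, hc, hp⟩ := hα p
    obtain ⟨d, hd, hp'⟩ := hα (E.inv q)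
    rw [← hp] at hpq
    obtain ⟨e, he, he'⟩ := hc.snoc hpq
    exact hN' _ (he.append hd.reverse (by rw [he', Nat.sub_zero, hp', E.inv_inv]))

/-! ### Gradings into each level structure. -/

theorem isGrading_DInf : E.IsGrading CoreName.DInf.level (fun _ => 1) :=
  ⟨fun _ => ⟨le_rfl, le_rfl, rfl⟩, fun _ _ _ _ _ _ _ hij h => le_trans h hij⟩

theorem exists_isGrading_BInf [Finite V] (hbad : ∀ p, ¬ (E.rel p (E.inv p) ∧ E.rel (E.inv p) p))
    (hsd : ∀ p, E.inv p ≠ p) : ∃ τ, E.IsGrading CoreName.BInf.level τ := by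
  classical
  obtain ⟨U, h1, h2, h3⟩ := E.exists_upset hbad
  refine ⟨fun p => if p ∈ U then 1 else 2, fun p => ?_, fun p q hpq i hi j hj hij => ?_⟩
  · change _ ∧ _ ≤ 2 ∧ _ = 2 + 1
    dsimp only
    by_cases hp : p ∈ U
    · rw [if_pos hp, if_neg (h2 p hp)]
      omega
    · rw [if_neg hp, if_pos ((h3 p (hsd p)).resolve_left hp)]
      omega
  · change i ≤ j at hij
    have := h1 p q
    dsimp only
    by_cases hp : p ∈ U
    · rw [if_pos hp, if_pos (h1 p q hp hpq)]
      omega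
    · rw [if_neg hp]
      split_ifs <;> omega

theorem exists_isGrading_CInf [Finite V]
    (hbad : ∀ p, ¬ (E.rel p (E.inv p) ∧ E.rel (E.inv p) p)) :
    ∃ τ, E.IsGrading CoreName.CInf.level τ := by
  classical
  obtain ⟨U, h1, h2, h3⟩ := E.exists_upset hbad
  refine ⟨fun p => if E.inv p = p then 2 else if p ∈ U then 1 else 3, fun p => ?_,
    fun p q hpq i hi j hj hij => ?_⟩
  · change _ ∧ _ ≤ 3 ∧ _ = 3 + 1
    dsimp only
    by_cases hs : E.inv p = p
    · rw [if_pos hs, if_pos (by rw [E.inv_inv, hs])]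
      omega
    · have hs' : ¬ E.inv (E.inv p) = E.inv p := by
        rw [E.inv_inv]
        exact Ne.symm hs
      rw [if_neg hs, if_neg hs']
      by_cases hp : p ∈ U
      · rw [if_pos hp, if_neg (h2 p hp)]
        omega
      · rw [if_neg hp, if_pos ((h3 p hs).resolve_left hp)]
        omega
  · change j ≤ 3 at hj
    change i ≤ 3 at hi
    change i ≤ j ∨ (i = 2 ∧ j = 1) at hij
    dsimp only
    by_cases hs : E.inv p = p
    · have hq := E.rel_inv _ _ hpq
      rw [hs] at hq
      have hq1 : ¬ E.inv q = q := fun h => by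
        rw [h] at hq
        have := E.trans _ _ _ hpq hq
        exact hbad p (by rw [hs]; exact ⟨this, this⟩)
      have hq2 : q ∈ U := by
        refine (h3 q hq1).resolve_right fun h => ?_
        have := h1 _ _ h hq
        exact h2 p this (by rwa [hs])
      rw [if_pos hs, if_neg hq1, if_pos hq2]
      omega
    · rw [if_neg hs]
      by_cases hp : p ∈ U
      · have hq2 := h1 p q hp hpq
        have hq1 : ¬ E.inv q = q := fun h => h2 q hq2 (by rwa [h])
        rw [if_pos hp, if_neg hq1, if_pos hq2]
        omega
      · rw [if_neg hp]
        split_ifs <;> omega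

theorem exists_choice [Finite V] (hirr : ∀ p, ¬ E.rel p p) (hsd : ∀ p, E.inv p ≠ p) :
    ∃ σ : V → ℕ, ∀ p, σ p + σ (E.inv p) = 1 := by
  classical
  obtain ⟨U, -, h2, h3⟩ := E.exists_upset fun p h => hirr p (E.trans _ _ _ h.1 h.2)
  refine ⟨fun p => if p ∈ U then 1 else 0, fun p => ?_⟩
  by_cases hp : p ∈ U
  · simp [hp, h2 p hp]
  · simp [hp, (h3 p (hsd p)).resolve_left hp]

section Height

variable {N : ℕ} {α : V → ℕ}

/-- Members lower than their duals take thresholds counted down from $2k$ by height, the others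
those forced by duality. Since $\tau(p)+\tau(p^d)=2k+1$ is odd, no threshold can be its own
complement, and `σ` breaks ties of height. -/
theorem exists_isGrading_A (h : E.IsHeight N α) {σ : V → ℕ} (hσ : ∀ p, σ p + σ (E.inv p) = 1) {k : ℕ} (hk : 1 ≤ k)
    (hN : N = 2 * k - 2) : ∃ τ, E.IsGrading (CoreName.A k hk).level τ := by
  refine ⟨fun p => if 2 * α p + σ p < 2 * α (E.inv p) + σ (E.inv p) then 2 * k - α p
    else 1 + α (E.inv p), fun p => ?_, fun p q hpq i hi j hj hij => ?_⟩
  · change _ ∧ _ ≤ 2 * k ∧ _ = 2 * k + 1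
    have := h.add_inv_le p
    have := hσ p
    dsimp only
    rw [E.inv_inv]
    split_ifs <;> omega
  · change i ≤ 2 * k at hi
    change j ≤ 2 * k at hj
    change i ≤ j + 1 ∨ (i = k + 1 ∧ j + 1 = k) at hij
    have := h.add_inv_le p
    have := h.add_inv_le q
    have := h.add_one_add_inv_le p q hpq
    have := h.add_one_le p q hpq
    have := h.add_one_le _ _ (E.rel_inv p q hpq)
    have := hσ p
    have := hσ q
    dsimp only
    split_ifs <;> omega

theorem exists_isGrading_B (h : E.IsHeight N α) {σ : V → ℕ} (hσ : ∀ p, σ p + σ (E.inv p) = 1) {k : ℕ} (hk : 1 ≤ k)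
    (hN : N = 2 * k - 1) : ∃ τ, E.IsGrading (CoreName.B k hk).level τ := by
  refine ⟨fun p => if 2 * α p + σ p < 2 * α (E.inv p) + σ (E.inv p) then 2 * k - α p
    else 1 + α (E.inv p), fun p => ?_, fun p q hpq i hi j hj hij => ?_⟩
  · change _ ∧ _ ≤ 2 * k ∧ _ = 2 * k + 1
    have := h.add_inv_le p
    have := hσ p
    dsimp only
    rw [E.inv_inv]
    split_ifs <;> omega
  · change i ≤ 2 * k at hi
    change j ≤ 2 * k at hj
    change i ≤ j + 1 at hij
    have := h.add_inv_le p
    have := h.add_inv_le q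
    have := h.add_one_add_inv_le p q hpq
    have := h.add_one_le p q hpq
    have := h.add_one_le _ _ (E.rel_inv p q hpq)
    have := hσ p
    have := hσ q
    dsimp only
    split_ifs <;> omega

/-- The thresholds now sum to $2k$, so members as high as their duals, in particular self-dual ones,
can take the value $k$. -/
theorem exists_isGrading_D (h : E.IsHeight N α) {k : ℕ} (hk : 1 ≤ k) (hN : N = 2 * k - 2) :
    ∃ τ, E.IsGrading (CoreName.D k hk).level τ := by
  refine ⟨fun p => if α p < α (E.inv p) then 2 * k - 1 - α p
    else if α (E.inv p) < α p then 1 + α (E.inv p) else k, fun p => ?_,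
      fun p q hpq i hi j hj hij => ?_⟩
  · change _ ∧ _ ≤ 2 * k - 1 ∧ _ = 2 * k - 1 + 1
    have := h.add_inv_le p
    dsimp only
    rw [E.inv_inv]
    split_ifs <;> omega
  · change i ≤ 2 * k - 1 at hi
    change j ≤ 2 * k - 1 at hj
    change i ≤ j + 1 at hij
    have := h.add_inv_le p
    have := h.add_inv_le q
    have := h.add_one_add_inv_le p q hpq
    have := h.add_one_le p q hpq
    have := h.add_one_le _ _ (E.rel_inv p q hpq)
    dsimp only
    split_ifs <;> omega

theorem exists_isGrading_C (h : E.IsHeight N α) {k : ℕ} (hk : 2 ≤ k) (hN : N = 2 * k - 3) :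
    ∃ τ, E.IsGrading (CoreName.C k hk).level τ := by
  refine ⟨fun p => if α p < α (E.inv p) then 2 * k - 1 - α p
    else if α (E.inv p) < α p then 1 + α (E.inv p) else k, fun p => ?_,
      fun p q hpq i hi j hj hij => ?_⟩
  · change _ ∧ _ ≤ 2 * k - 1 ∧ _ = 2 * k - 1 + 1
    have := h.add_inv_le p
    dsimp only
    rw [E.inv_inv]
    split_ifs <;> omega
  · change i ≤ 2 * k - 1 at hi
    change j ≤ 2 * k - 1 at hj
    change i ≤ j + 1 ∨ (i = k ∧ j + 2 = k) ∨ (i = k + 1 ∧ j + 1 = k) at hij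
    have := h.add_inv_le p
    have := h.add_inv_le q
    have := h.add_one_add_inv_le p q hpq
    have := h.add_one_le p q hpq
    have := h.add_one_le _ _ (E.rel_inv p q hpq)
    dsimp only
    split_ifs <;> omega

end Height

end InvRel

/-- The relation `◁` on a set of Boolean functionals closed under duality. -/
def BoolFunctional.invRel {M : Minion.{u}} (V : Set (BoolFunctional M))
    (hV : ∀ F ∈ V, F.dual ∈ V) : InvRel V where
  inv := fun F => ⟨F.1.dual, hV _ F.2⟩
  rel := fun F G => F.1.Tri G.1
  inv_inv := fun F => Subtype.ext F.1.dual_dual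
  trans := fun _ _ _ h h' => h.trans h'
  rel_inv := fun _ _ h => h.dual

theorem BoolFunctional.exists_grading {M : Minion.{u}} (V : Set (BoolFunctional M))
    (hV : ∀ F ∈ V, F.dual ∈ V) [Finite V] [Nonempty V] :
    ∃ c : CoreName, 1 ≤ c.level.top ∧ M.HomLE c.minion ∧
      ∃ τ, (invRel V hV).IsGrading c.level τ := by
  by_cases hbad : ∃ p, (invRel V hV).rel p ((invRel V hV).inv p) ∧
      (invRel V hV).rel ((invRel V hV).inv p) p
  · obtain ⟨p, hp⟩ := hbad
    exact ⟨.DInf, le_rfl, homLE_DInf hp.1 hp.2, _, InvRel.isGrading_DInf⟩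
  have hbad' := not_exists.mp hbad
  by_cases hsd : ∃ p, (invRel V hV).inv p = p
  · obtain ⟨s, hs⟩ := hsd
    have hs' : s.1 = s.1.dual := (congrArg Subtype.val hs).symm
    by_cases hirr : ∃ p, (invRel V hV).rel p p
    · obtain ⟨p, hp⟩ := hirr
      exact ⟨.CInf, by decide, homLE_CInf hp hs', InvRel.exists_isGrading_CInf hbad'⟩
    · obtain ⟨N, α, ⟨c, hc⟩, h⟩ := InvRel.exists_height (not_exists.mp hirr)
      rcases Nat.even_or_odd' N with ⟨t, rfl | rfl⟩
      · refine ⟨.D (t + 1) (by omega), ?_, IsWalk.homLE_D (c := fun i => (c i).1) hc hs',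
          InvRel.exists_isGrading_D h _ (by omega)⟩
        change 1 ≤ 2 * (t + 1) - 1
        omega
      · refine ⟨.C (t + 2) (by omega), ?_,
          IsWalk.homLE_C (c := fun i => (c i).1) (by omega) hc hs',
          InvRel.exists_isGrading_C h _ (by omega)⟩
        change 1 ≤ 2 * (t + 2) - 1
        omega
  · have hsd' := not_exists.mp hsd
    by_cases hirr : ∃ p, (invRel V hV).rel p p
    · obtain ⟨p, hp⟩ := hirr
      exact ⟨.BInf, by decide, homLE_BInf hp, InvRel.exists_isGrading_BInf hbad' hsd'⟩
    · obtain ⟨σ, hσ⟩ := InvRel.exists_choice (not_exists.mp hirr) hsd'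
      obtain ⟨N, α, ⟨c, hc⟩, h⟩ := InvRel.exists_height (not_exists.mp hirr)
      rcases Nat.even_or_odd' N with ⟨t, rfl | rfl⟩
      · refine ⟨.A (t + 1) (by omega), ?_, IsWalk.homLE_A (c := fun i => (c i).1) hc,
          InvRel.exists_isGrading_A h hσ _ (by omega)⟩
        change 1 ≤ 2 * (t + 1)
        omega
      · refine ⟨.B (t + 1) (by omega), ?_, IsWalk.homLE_B (c := fun i => (c i).1) hc,
          InvRel.exists_isGrading_B h hσ _ (by omega)⟩
        change 1 ≤ 2 * (t + 1)
        omega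

/-! ### Reduction to idempotent polymorphisms -/

/-- The unary relation `{a}`. -/
def FinitaryRel.singleton {A : Type u} (a : A) : FinitaryRel A := ⟨1, {fun _ => a}⟩

theorem FinitaryRel.hasSmallProjections_of_pair {A : Type u} {R : FinitaryRel A}
    (h : ∀ j, ∃ x y, ∀ t ∈ R.tuples, t j = x ∨ t j = y) : R.HasSmallProjections := by
  intro j
  obtain ⟨x, y, hxy⟩ := h j
  have hsub : (fun t : Fin R.arity → A => t j) '' R.tuples ⊆ {x, y} := by
    rintro _ ⟨t, ht, rfl⟩
    exact hxy t ht
  refine (Set.encard_le_encard hsub).trans ((Set.encard_insert_le _ _).trans ?_)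
  rw [Set.encard_singleton]
  decide

theorem FinitaryRel.singleton_small {A : Type u} (a : A) :
    ((singleton a).arity : ℕ) ≤ 2 ∧ (singleton a).HasSmallProjections := by
  refine ⟨one_le_two, hasSmallProjections_of_pair fun j => ⟨a, a, ?_⟩⟩
  rintro t rfl
  exact Or.inl rfl

theorem Operation.apply_const_of_preserves {A : Type u} {n : ℕ+} {f : Operation A n} {a : A}
    (h : f.Preserves (FinitaryRel.singleton a)) : f (fun _ => a) = a :=
  congrFun (h (fun _ _ => a) fun _ => rfl) ⟨0, (FinitaryRel.singleton a).arity.pos⟩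

/-- The restriction of a relation to a subset. -/
def FinitaryRel.restrict {A : Type u} (R : FinitaryRel A) (B : Set A) : FinitaryRel B :=
  ⟨R.arity, {t | (fun j => (t j : A)) ∈ R.tuples}⟩

theorem FinitaryRel.HasSmallProjections.restrict {A : Type u} {R : FinitaryRel A}
    (h : R.HasSmallProjections) (B : Set A) : (R.restrict B).HasSmallProjections := by
  intro j
  refine le_trans ?_ (h j)
  rw [← Subtype.val_injective.encard_image ((fun t => t j) '' (R.restrict B).tuples)]
  refine Set.encard_le_encard ?_
  rintro _ ⟨_, ⟨t, ht, rfl⟩, rfl⟩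
  exact ⟨_, ht, rfl⟩

/-- `e` preserves all relations in `Ψ`. -/
def IsRelEndo {A : Type u} (Ψ : Set (FinitaryRel A)) (e : A → A) : Prop :=
  ∀ R ∈ Ψ, ∀ t ∈ R.tuples, (fun j => e (t j)) ∈ R.tuples

theorem IsRelEndo.comp {A : Type u} {Ψ : Set (FinitaryRel A)} {e g : A → A}
    (he : IsRelEndo Ψ e) (hg : IsRelEndo Ψ g) : IsRelEndo Ψ (fun x => e (g x)) :=
  fun R hR t ht => he R hR _ (hg R hR t ht)

/-- Choose `e` with range of least size. Then $e\circ g\circ e$ cannot have a smaller range, so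
nothing is identified on the range of `e`. -/
theorem exists_minimal_endo {A : Type u} [Finite A] (Ψ : Set (FinitaryRel A)) :
    ∃ e : A → A, IsRelEndo Ψ e ∧ ∀ g, IsRelEndo Ψ g →
      Set.InjOn (fun x => e (g x)) (Set.range e) := by
  obtain ⟨e, he, hmin⟩ := (Set.toFinite {e : A → A | IsRelEndo Ψ e}).exists_minimalFor
    (fun e => (Set.range e).ncard) _ ⟨fun x => x, fun R _ t ht => ht⟩
  refine ⟨e, he, fun g hg => ?_⟩
  have hsub : Set.range (fun x => e (g (e x))) ⊆ Set.range e := by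
    rintro _ ⟨x, rfl⟩
    exact ⟨_, rfl⟩
  have hle := Set.ncard_le_ncard hsub
  have hge := hmin (show IsRelEndo Ψ (fun x => e (g (e x))) from
    IsRelEndo.comp he (IsRelEndo.comp hg he)) hle
  refine Set.injOn_of_ncard_image_eq ?_
  rw [← Set.range_comp]
  exact le_antisymm hle hge

/-- Restrict a finite structure to the range of a minimal endomorphism and add constants. -/
theorem exists_idempotent_reduct {A : Type u} [Finite A] (Ψ : Set (FinitaryRel A))
    (hΨ : ∀ R ∈ Ψ, (R.arity : ℕ) ≤ 2 ∧ R.HasSmallProjections) :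
    ∃ (B : Set A) (Ψ' : Set (FinitaryRel B)),
      (∀ R ∈ Ψ', (R.arity : ℕ) ≤ 2 ∧ R.HasSmallProjections) ∧
      (∀ b, FinitaryRel.singleton b ∈ Ψ') ∧ (Pol Ψ).Equivalent (Pol Ψ') := by
  obtain ⟨e, he, hinj⟩ := exists_minimal_endo Ψ
  let B : Set A := Set.range e
  let Ψ' : Set (FinitaryRel B) :=
    {R | (∃ R₀ ∈ Ψ, R₀.restrict B = R) ∨ ∃ b, FinitaryRel.singleton b = R}
  have hu : ∀ {n : ℕ+} (f : (Pol Ψ).carrier n), IsRelEndo Ψ (fun x => f.1 fun _ => x) :=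
    fun f R hR t ht => f.2 R hR (fun _ => t) fun _ => ht
  let π : ∀ {n : ℕ+}, (Pol Ψ).carrier n → B → B :=
    fun f b => ⟨e (f.1 fun _ => b), Set.mem_range_self _⟩
  have hπ : ∀ {n : ℕ+} (f : (Pol Ψ).carrier n), Function.Injective (π f) := by
    intro n f b b' h
    exact Subtype.ext (hinj _ (hu f) b.2 b'.2 (congrArg Subtype.val h))
  -- The unary part of `f`, followed by `e`, permutes the range. Undoing it makes `f` idempotent,
  -- and since it is unchanged by taking minors the correction is a homomorphism.
  let σ : ∀ {n : ℕ+}, (Pol Ψ).carrier n → Equiv.Perm B :=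
    fun f => Equiv.ofBijective (π f) (Finite.injective_iff_bijective.mp (hπ f))
  have hσ : ∀ {n : ℕ+} (f : (Pol Ψ).carrier n), ∀ R ∈ Ψ, ∀ t ∈ (R.restrict B).tuples,
      (fun j => (σ f).symm (t j)) ∈ (R.restrict B).tuples := by
    intro n f R hR t ht
    have hmaps : ∀ t ∈ (R.restrict B).tuples, (fun j => σ f (t j)) ∈ (R.restrict B).tuples :=
      fun t ht => he R hR _ (hu f R hR _ ht)
    let θ : (R.restrict B).tuples → (R.restrict B).tuples := fun t => ⟨_, hmaps t.1 t.2⟩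
    have hθ : Function.Injective θ := by
      intro t t' h
      refine Subtype.ext (funext fun j => (σ f).injective ?_)
      exact congrFun (congrArg Subtype.val h) j
    -- An injective self-map of a finite relation is onto, hence the inverse permutation preserves
    -- the relation too.
    obtain ⟨s, hs⟩ := Finite.surjective_of_injective hθ ⟨t, ht⟩
    have hs' : ∀ j, σ f (s.1 j) = t j := fun j => congrFun (congrArg Subtype.val hs) j
    have : (fun j => (σ f).symm (t j)) = s.1 := by
      funext j
      rw [← hs' j, Equiv.symm_apply_apply]
    rw [this]
    exact s.2
  refine ⟨B, Ψ', ?_, fun b => Or.inr ⟨b, rfl⟩, ⟨⟨fun n f => ⟨fun a =>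
    (σ f).symm ⟨e (f.1 fun i => a i), Set.mem_range_self _⟩, ?_⟩, fun α f => rfl⟩⟩,
    ⟨⟨fun n f => ⟨fun a => f.1 fun i => ⟨e (a i), Set.mem_range_self _⟩, ?_⟩, fun α f => rfl⟩⟩⟩
  · rintro R (⟨R₀, hR₀, rfl⟩ | ⟨b, rfl⟩)
    · exact ⟨(hΨ R₀ hR₀).1, (hΨ R₀ hR₀).2.restrict B⟩
    · exact FinitaryRel.singleton_small b
  · rintro R (⟨R₀, hR₀, rfl⟩ | ⟨b, rfl⟩) r hr
    · exact hσ f R₀ hR₀ _ (he R₀ hR₀ _ (f.2 R₀ hR₀ (fun i j => r i j) hr))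
    · funext j
      have hr' : ∀ i, r i j = b := fun i => congrFun (hr i) j
      simp only [hr']
      exact (σ f).symm_apply_apply b
  · intro R hR r hr
    exact f.2 _ (Or.inl ⟨R, hR, rfl⟩) (fun i j => ⟨e (r i j), Set.mem_range_self _⟩)
      fun i => he R hR _ (hr i)

/-! ### Classification of idempotent polymorphism minions -/

section Idempotent

variable {A : Type u} {Ψ : Set (FinitaryRel A)} (hs : ∀ a, FinitaryRel.singleton a ∈ Ψ)

open Classical in
/-- The Boolean operation describing the action of a polymorphism on the pair `x ≠ y`. -/
noncomputable def pairFunctional {x y : A} (hxy : x ≠ y) : BoolFunctional (Pol Ψ) where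
  toFun := fun _ f b => decide (f.1 (fun i => if b i then y else x) = y)
  map_minor := fun _ _ => rfl
  idempotent := fun n f b => by
    cases b
    · refine decide_eq_false ?_
      simp only [Bool.false_eq_true, if_false]
      rwa [Operation.apply_const_of_preserves (f.2 _ (hs x))]
    · refine decide_eq_true ?_
      simp only [if_true]
      exact Operation.apply_const_of_preserves (f.2 _ (hs y))

/-- A choice of `pairFunctional` or its dual, according to an ordering of the elements. -/
noncomputable def orientedFunctional (idx : A → ℕ) {x y : A} (hxy : x ≠ y) :
    BoolFunctional (Pol Ψ) :=
  if idx x < idx y then pairFunctional hs hxy else (pairFunctional hs hxy.symm).dual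

theorem orientedFunctional_dual {idx : A → ℕ} (hidx : Function.Injective idx) {x y : A}
    (hxy : x ≠ y) :
    (orientedFunctional hs idx hxy).dual = orientedFunctional hs idx hxy.symm := by
  unfold orientedFunctional
  rcases Nat.lt_or_gt_of_ne (fun h => hxy (hidx h)) with h | h
  · rw [if_pos h, if_neg (by omega)]
  · rw [if_neg (by omega), if_pos h, BoolFunctional.dual_dual]

theorem FinitaryRel.HasSmallProjections.eq_or_eq {R : FinitaryRel A} (hR : R.HasSmallProjections)
    {p : Fin R.arity} {t₁ t₂ : Fin R.arity → A} (h₁ : t₁ ∈ R.tuples) (h₂ : t₂ ∈ R.tuples)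
    (hne : t₁ p ≠ t₂ p) {t : Fin R.arity → A} (ht : t ∈ R.tuples) : t p = t₁ p ∨ t p = t₂ p := by
  have hr : ∀ i : Fin (⟨3, three_pos⟩ : ℕ+),
      ![t₁, t₂, t] i p ∈ (fun t : Fin R.arity → A => t p) '' R.tuples := by
    intro i
    change Fin 3 at i
    fin_cases i
    · exact ⟨t₁, h₁, rfl⟩
    · exact ⟨t₂, h₂, rfl⟩
    · exact ⟨t, ht, rfl⟩
  obtain ⟨x, y, hxy⟩ := exists_pair_of_encard_le_two (hR p) hr
  have e0 : t₁ p = x ∨ t₁ p = y := hxy (0 : Fin 3)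
  have e1 : t₂ p = x ∨ t₂ p = y := hxy (1 : Fin 3)
  have e2 : t p = x ∨ t p = y := hxy (2 : Fin 3)
  rcases e0 with h0 | h0 <;> rcases e1 with h1 | h1 <;> rcases e2 with h2 | h2 <;> simp_all

/-- In general a polymorphism may leave $\{x,y\}$, and then exchanging $x$ and $y$ is not duality
for `pairFunctional`. If both elements occur in one projection of a relation, the values stay in the
pair and the orientation is immaterial. These are the only pairs on which compatibility imposes a
condition. -/
theorem orientedFunctional_eq (idx : A → ℕ) {R : FinitaryRel A} (hRΨ : R ∈ Ψ)
    (hR : R.HasSmallProjections) {p : Fin R.arity} {t₁ t₂ : Fin R.arity → A}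
    (h₁ : t₁ ∈ R.tuples) (h₂ : t₂ ∈ R.tuples) (hne : t₁ p ≠ t₂ p) :
    orientedFunctional hs idx hne = pairFunctional hs hne := by
  classical
  unfold orientedFunctional
  split_ifs with h
  · rfl
  · ext1
    funext n f b
    have hmem := f.2 R hRΨ (fun i => if b i then t₂ else t₁) (fun i => by split_ifs <;> assumption)
    have hor := hR.eq_or_eq h₁ h₂ hne hmem
    have hfun : (fun i => (if b i then t₂ else t₁) p) = fun i => if b i then t₂ p else t₁ p := by
      funext i
      split_ifs <;> rfl
    have hfun' : (fun i => if !(b i) then t₁ p else t₂ p) = fun i => if b i then t₂ p else t₁ p := by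
      funext i
      cases b i <;> rfl
    simp only [hfun] at hor
    change (!decide (f.1 (fun i => if !(b i) then t₁ p else t₂ p) = t₁ p)) =
      decide (f.1 (fun i => if b i then t₂ p else t₁ p) = t₂ p)
    rw [hfun']
    rcases hor with h | h
    · simp [h, hne]
    · simp [h, hne.symm]

theorem hasPair_of_preserves {R : FinitaryRel A} (hRΨ : R ∈ Ψ) {p q : Fin R.arity} {n : ℕ+}
    (f : (Pol Ψ).carrier n) {a b : Fin n → A} (hab : ∀ i, R.HasPair p q (a i) (b i)) :
    R.HasPair p q (f.1 a) (f.1 b) := by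
  choose t ht hp hq using hab
  refine ⟨_, f.2 R hRΨ t ht, ?_, ?_⟩
  · simp only [hp]
  · simp only [hq]

theorem FinitaryRel.HasSmallProjections.pairFunctional_tri {R : FinitaryRel A}
    (hR : R.HasSmallProjections) (hRΨ : R ∈ Ψ) {p q : Fin R.arity} {x y z w : A} (hxy : x ≠ y)
    (hzw : z ≠ w) (hxz : R.HasPair p q x z) (hyw : R.HasPair p q y w)
    (hyz : ¬ R.HasPair p q y z) (hxw : R.HasPair p q x w) :
    (pairFunctional hs hxy).Tri (pairFunctional hs hzw) := by
  classical
  intro n f a b hab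
  rw [Bool.le_iff_of_imp]
  change decide _ = true → decide _ = true
  rw [decide_eq_true_iff, decide_eq_true_iff]
  intro hy
  have h := hasPair_of_preserves hRΨ f (p := p) (q := q) (a := fun i => if a i then y else x)
    (b := fun i => if b i then w else z) (fun i => by
      have := hab i
      revert this
      cases a i <;> cases b i <;> intro this
      · exact hxz
      · exact hxw
      · exact absurd this (by simp)
      · exact hyw)
  rw [hy] at h
  obtain ⟨t, ht, h1, h2⟩ := h
  obtain ⟨t₁, ht₁, -, rfl⟩ := hxz
  obtain ⟨t₂, ht₂, -, rfl⟩ := hyw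
  rcases hR.eq_or_eq ht₁ ht₂ hzw ht with h3 | h3
  · exact absurd ⟨t, ht, h1, h3⟩ hyz
  · rw [← h2, h3]

theorem FinitaryRel.HasSmallProjections.pairFunctional_eq {R : FinitaryRel A}
    (hR : R.HasSmallProjections) (hRΨ : R ∈ Ψ) {p q : Fin R.arity} {x y z w : A} (hxy : x ≠ y)
    (hzw : z ≠ w) (hxz : R.HasPair p q x z) (hyw : R.HasPair p q y w)
    (hyz : ¬ R.HasPair p q y z) (hxw : ¬ R.HasPair p q x w) :
    pairFunctional hs hxy = pairFunctional hs hzw := by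
  classical
  ext1
  funext n f a
  change decide _ = decide _
  have h := hasPair_of_preserves hRΨ f (p := p) (q := q) (a := fun i => if a i then y else x)
    (b := fun i => if a i then w else z) (fun i => by cases a i <;> assumption)
  obtain ⟨t, ht, h1, h2⟩ := h
  obtain ⟨t₁, ht₁, rfl, rfl⟩ := hxz
  obtain ⟨t₂, ht₂, rfl, rfl⟩ := hyw
  rw [decide_eq_decide, ← h1, ← h2]
  constructor
  · intro h3
    exact (hR.eq_or_eq ht₁ ht₂ hzw ht).resolve_left fun h4 => hyz ⟨t, ht, h3, h4⟩
  · intro h3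
    exact (hR.eq_or_eq ht₁ ht₂ hxy ht).resolve_left fun h4 => hxw ⟨t, ht, h4, h3⟩

theorem exists_equivalent_of_nontrivial [Finite A] [Nontrivial A]
    (hs : ∀ a, FinitaryRel.singleton a ∈ Ψ)
    (hΨ : ∀ R ∈ Ψ, (R.arity : ℕ) ≤ 2 ∧ R.HasSmallProjections) :
    ∃ c : CoreName, (Pol Ψ).Equivalent c.minion := by
  classical
  let idx : A → ℕ := fun a => Finite.equivFin A a
  have hidx : Function.Injective idx := fun a b h => (Finite.equivFin A).injective (Fin.ext h)
  let V : Set (BoolFunctional (Pol Ψ)) :=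
    Set.range fun p : {p : A × A // p.1 ≠ p.2} => orientedFunctional hs idx p.2
  have hV : ∀ F ∈ V, F.dual ∈ V := by
    rintro _ ⟨⟨⟨x, y⟩, h⟩, rfl⟩
    exact ⟨⟨⟨y, x⟩, h.symm⟩, (orientedFunctional_dual hs hidx h).symm⟩
  obtain ⟨x₀, y₀, h₀⟩ := exists_pair_ne A
  have : Nonempty V := ⟨⟨_, ⟨⟨⟨x₀, y₀⟩, h₀⟩, rfl⟩⟩⟩
  obtain ⟨c, hc, hle, τ, hτ1, hτ2⟩ := BoolFunctional.exists_grading V hV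
  refine ⟨c, hle, c.homLE_level.trans ?_⟩
  let F : ∀ {x y : A}, x ≠ y → V := fun {x y} h =>
    ⟨orientedFunctional hs idx h, ⟨⟨⟨x, y⟩, h⟩, rfl⟩⟩
  refine LevelStructure.homLE_Pol (τ := fun x y => if h : x ≠ y then τ (F h) else 0) hc ?_ hΨ ?_
  · intro x y hxy
    dsimp only
    rw [dif_pos hxy, dif_pos hxy.symm]
    have h1 := hτ1 (F hxy)
    have h2 : (BoolFunctional.invRel V hV).inv (F hxy) = F hxy.symm :=
      Subtype.ext (orientedFunctional_dual hs hidx hxy)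
    rwa [h2] at h1
  · intro R hR p q x y z w hxy hzw hxz hyw hyz
    dsimp only
    rw [dif_pos hxy, dif_pos hzw]
    have hRs := (hΨ R hR).2
    have e1 : orientedFunctional hs idx hxy = pairFunctional hs hxy := by
      obtain ⟨t₁, ht₁, rfl, -⟩ := hxz
      obtain ⟨t₂, ht₂, rfl, -⟩ := hyw
      exact orientedFunctional_eq hs idx hR hRs ht₁ ht₂ hxy
    have e2 : orientedFunctional hs idx hzw = pairFunctional hs hzw := by
      obtain ⟨t₁, ht₁, -, rfl⟩ := hxz
      obtain ⟨t₂, ht₂, -, rfl⟩ := hyw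
      exact orientedFunctional_eq hs idx hR hRs ht₁ ht₂ hzw
    refine ⟨fun hxw => hτ2 _ _ ?_, fun hxw => congrArg τ (Subtype.ext ?_)⟩
    · change (orientedFunctional hs idx hxy).Tri (orientedFunctional hs idx hzw)
      rw [e1, e2]
      exact hRs.pairFunctional_tri hs hR hxy hzw hxz hyw hyz hxw
    · change orientedFunctional hs idx hxy = orientedFunctional hs idx hzw
      rw [e1, e2]
      exact hRs.pairFunctional_eq hs hR hxy hzw hxz hyw hyz hxw

end Idempotent

theorem equivalent_T_of_subsingleton {A : Type u} [Subsingleton A] (Ψ : Set (FinitaryRel A)) :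
    (Pol Ψ).Equivalent CoreName.T.minion :=
  ⟨⟨⟨fun _ _ _ => (), fun _ _ => rfl⟩⟩,
    ⟨⟨fun n _ => ((Pol Ψ).nonempty n).some, fun _ _ => Subtype.ext (Subsingleton.elim _ _)⟩⟩⟩

theorem Minion.Equivalent.trans {M : Minion.{u}} {N : Minion.{v}} {K : Minion.{w}}
    (h : M.Equivalent N) (h' : N.Equivalent K) : M.Equivalent K :=
  ⟨h.1.trans h'.1, h'.2.trans h.2⟩

theorem exists_equivalent_minion {A : Type u} [Finite A] (Ψ : Set (FinitaryRel A))
    (hΨ : ∀ R ∈ Ψ, (R.arity : ℕ) ≤ 2 ∧ R.HasSmallProjections) :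
    ∃ c : CoreName, (Pol Ψ).Equivalent c.minion := by
  obtain ⟨B, Ψ', h1, h2, h3⟩ := exists_idempotent_reduct Ψ hΨ
  rcases subsingleton_or_nontrivial B with hB | hB
  · exact ⟨.T, h3.trans (equivalent_T_of_subsingleton Ψ')⟩
  · obtain ⟨c, hc⟩ := exists_equivalent_of_nontrivial h2 h1
    exact ⟨c, h3.trans hc⟩

/-! ### Realization of the listed minions -/

/-- The relation on two sorts saying that the bit of sort `s` is at most that of sort `t`. -/
def implRel {N : ℕ} (s t : Fin N) : FinitaryRel (Fin N × Bool) :=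
  ⟨2, {r | ∃ b c : Bool, b ≤ c ∧ r ⟨0, by decide⟩ = (s, b) ∧ r ⟨1, by decide⟩ = (t, c)}⟩

/-- The disequality relation on the sort `s`. -/
def negRel {N : ℕ} (s : Fin N) : FinitaryRel (Fin N × Bool) :=
  ⟨2, {r | ∃ b : Bool, r ⟨0, by decide⟩ = (s, b) ∧ r ⟨1, by decide⟩ = (s, !b)}⟩

/-- Constants together with implications for the pairs in `E` and disequalities for `D`. -/
def sortedRels {N : ℕ} (E : Fin N → Fin N → Prop) (D : Fin N → Prop) :
    Set (FinitaryRel (Fin N × Bool)) :=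
  {R | (∃ a, FinitaryRel.singleton a = R) ∨ (∃ s t, E s t ∧ implRel s t = R) ∨
    ∃ s, D s ∧ negRel s = R}

theorem forall_fin_two {P : Fin (2 : ℕ+) → Prop} (h0 : P ⟨0, by decide⟩) (h1 : P ⟨1, by decide⟩) :
    ∀ j, P j := by
  rintro ⟨j, hj⟩
  rcases j with _ | _ | j
  · exact h0
  · exact h1
  · exact absurd (show j + 1 + 1 < 2 from hj) (by omega)

theorem sortedRels_small {N : ℕ} {E : Fin N → Fin N → Prop} {D : Fin N → Prop} :
    ∀ R ∈ sortedRels E D, (R.arity : ℕ) ≤ 2 ∧ R.HasSmallProjections := by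
  rintro R (⟨a, rfl⟩ | ⟨s, t, -, rfl⟩ | ⟨s, -, rfl⟩)
  · exact FinitaryRel.singleton_small a
  · refine ⟨le_rfl, FinitaryRel.hasSmallProjections_of_pair (forall_fin_two
      ⟨(s, false), (s, true), ?_⟩ ⟨(t, false), (t, true), ?_⟩)⟩
    · rintro r ⟨b, c, -, h, -⟩
      rw [h]
      cases b <;> simp
    · rintro r ⟨b, c, -, -, h⟩
      rw [h]
      cases c <;> simp
  · refine ⟨le_rfl, FinitaryRel.hasSmallProjections_of_pair (forall_fin_two
      ⟨(s, false), (s, true), ?_⟩ ⟨(s, false), (s, true), ?_⟩)⟩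
    · rintro r ⟨b, h, -⟩
      rw [h]
      cases b <;> simp
    · rintro r ⟨b, -, h⟩
      rw [h]
      cases b <;> simp

/-- The action of a polymorphism of `sortedRels E D` on the sort `s`. -/
def sortFunctional {N : ℕ} (E : Fin N → Fin N → Prop) (D : Fin N → Prop) (s : Fin N) :
    BoolFunctional (Pol (sortedRels E D)) where
  toFun := fun _ f b => (f.1 fun i => (s, b i)).2
  map_minor := fun _ _ => rfl
  idempotent := fun _ f b => congrArg Prod.snd
    (Operation.apply_const_of_preserves (f.2 _ (Or.inl ⟨(s, b), rfl⟩)))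

theorem sortFunctional_tri {N : ℕ} {E : Fin N → Fin N → Prop} {D : Fin N → Prop} {s t : Fin N}
    (h : E s t) : (sortFunctional E D s).Tri (sortFunctional E D t) := by
  intro n f a b hab
  obtain ⟨x, y, hxy, hx, hy⟩ := f.2 (implRel s t) (Or.inr (Or.inl ⟨s, t, h, rfl⟩))
    (fun i => ![(s, a i), (t, b i)]) fun i => ⟨a i, b i, hab i, rfl, rfl⟩
  have hx' : (f.1 fun i => (s, a i)) = (s, x) := hx
  have hy' : (f.1 fun i => (t, b i)) = (t, y) := hy
  change (f.1 fun i => (s, a i)).2 ≤ (f.1 fun i => (t, b i)).2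
  rwa [hx', hy']

theorem sortFunctional_eq_dual {N : ℕ} {E : Fin N → Fin N → Prop} {D : Fin N → Prop} {s : Fin N}
    (h : D s) : sortFunctional E D s = (sortFunctional E D s).dual := by
  ext1
  funext n f a
  obtain ⟨x, hx, hy⟩ := f.2 (negRel s) (Or.inr (Or.inr ⟨s, h, rfl⟩))
    (fun i => ![(s, a i), (s, !(a i))]) fun i => ⟨a i, rfl, rfl⟩
  have hx' : (f.1 fun i => (s, a i)) = (s, x) := hx
  have hy' : (f.1 fun i => (s, !(a i))) = (s, !x) := hy
  change (f.1 fun i => (s, a i)).2 = !(f.1 fun i => (s, !(a i))).2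
  rw [hx', hy', Bool.not_not]

/-- Thresholds for pairs of sorted bits, extending thresholds for the sorts. -/
def sortThreshold {N : ℕ} (m : ℕ) (t : Fin N → ℕ) (x y : Fin N × Bool) : ℕ :=
  match x.2, y.2 with
  | false, true => t x.1
  -- The sort of `y` is used because this is the complement of the threshold of the exchanged pair.
  -- The remaining cases involve distinct sorts whenever `x` and `y` differ, and only need to be
  -- complementary.
  | true, false => m + 1 - t y.1
  | _, _ => if x.1 < y.1 then 1 else m

theorem isThreshold_sortThreshold {N m : ℕ} (hm : 1 ≤ m) {t : Fin N → ℕ}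
    (ht : ∀ s, 1 ≤ t s ∧ t s ≤ m) : IsThreshold m (sortThreshold m t) := by
  rintro ⟨s, b⟩ ⟨s', b'⟩ hne
  have h1 := ht s
  have h2 := ht s'
  cases b <;> cases b' <;> simp only [sortThreshold]
  · have hss : s ≠ s' := fun h => hne (by rw [h])
    rcases lt_or_gt_of_ne hss with h | h
    · rw [if_pos h, if_neg (lt_asymm h)]
      omega
    · rw [if_neg (lt_asymm h), if_pos h]
      omega
  · omega
  · omega
  · have hss : s ≠ s' := fun h => hne (by rw [h])
    rcases lt_or_gt_of_ne hss with h | h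
    · rw [if_pos h, if_neg (lt_asymm h)]
      omega
    · rw [if_neg (lt_asymm h), if_pos h]
      omega

theorem sortedRels_isCompatible {N : ℕ} {E : Fin N → Fin N → Prop} {D : Fin N → Prop}
    {L : LevelStructure} {t : Fin N → ℕ} (ht : ∀ s, 1 ≤ t s ∧ t s ≤ L.top)
    (hE : ∀ s s', E s s' → ∀ i ≤ L.top, ∀ j ≤ L.top, L.rel i j → t s ≤ i → t s' ≤ j)
    (hD : ∀ s, D s → 2 * t s = L.top + 1) :
    ∀ R ∈ sortedRels E D, R.IsCompatible L (sortThreshold L.top t) := by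
  have diag : ∀ (R : FinitaryRel (Fin N × Bool)) (p : Fin R.arity) (x y z w), x ≠ y → z ≠ w →
      R.HasPair p p x z → R.HasPair p p y w → ¬ R.HasPair p p y z →
      (R.HasPair p p x w → ∀ i ≤ L.top, ∀ j ≤ L.top, L.rel i j →
        sortThreshold L.top t x y ≤ i → sortThreshold L.top t z w ≤ j) ∧
      (¬ R.HasPair p p x w → sortThreshold L.top t x y = sortThreshold L.top t z w) := by
    rintro R p x y z w hxy hzw ⟨t₁, -, rfl, rfl⟩ ⟨t₂, -, rfl, rfl⟩ -
    refine ⟨?_, fun _ => rfl⟩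
    rintro ⟨t₃, -, h1, h2⟩
    exact absurd (h1.symm.trans h2) hxy
  rintro R (⟨a, rfl⟩ | ⟨s, s', hss, rfl⟩ | ⟨s, hs, rfl⟩)
  · rintro p q x y z w hxy hzw ⟨t₁, ht₁, rfl, -⟩ ⟨t₂, ht₂, rfl, -⟩ -
    have e1 := congrFun (show t₁ = fun _ => a from ht₁) p
    have e2 := congrFun (show t₂ = fun _ => a from ht₂) p
    exact absurd (e1.trans e2.symm) hxy
  · have p01 : ∀ x z, (implRel s s').HasPair ⟨0, Nat.zero_lt_two⟩ ⟨1, Nat.one_lt_two⟩ x z ↔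
        ∃ b c : Bool, b ≤ c ∧ x = (s, b) ∧ z = (s', c) := by
      intro x z
      constructor
      · rintro ⟨r, ⟨b, c, hbc, h1, h2⟩, rfl, rfl⟩
        exact ⟨b, c, hbc, h1, h2⟩
      · rintro ⟨b, c, hbc, rfl, rfl⟩
        exact ⟨![(s, b), (s', c)], ⟨b, c, hbc, rfl, rfl⟩, rfl, rfl⟩
    have p10 : ∀ x z, (implRel s s').HasPair ⟨1, Nat.one_lt_two⟩ ⟨0, Nat.zero_lt_two⟩ x z ↔
        ∃ b c : Bool, b ≤ c ∧ z = (s, b) ∧ x = (s', c) := by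
      intro x z
      rw [← p01 z x]
      exact ⟨fun ⟨r, h, h1, h2⟩ => ⟨r, h, h2, h1⟩, fun ⟨r, h, h1, h2⟩ => ⟨r, h, h2, h1⟩⟩
    have hE' := hE s s' hss
    have hs := ht s
    have hs' := ht s'
    refine forall_fin_two (forall_fin_two (diag _ _) ?_) (forall_fin_two ?_ (diag _ _))
    · intro x y z w hxy hzw hxz hyw hyz
      obtain ⟨b, c, hbc, rfl, rfl⟩ := (p01 _ _).mp hxz
      obtain ⟨b', c', hbc', rfl, rfl⟩ := (p01 _ _).mp hyw
      have hb : ¬ b' ≤ c := fun h => hyz ((p01 _ _).mpr ⟨b', c, h, rfl, rfl⟩)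
      obtain ⟨rfl, rfl⟩ : b' = true ∧ c = false := by
        revert hb
        cases b' <;> cases c <;> simp
      obtain rfl : b = false := by
        cases b
        · rfl
        · exact absurd rfl hxy
      obtain rfl : c' = true := by
        cases c'
        · exact absurd rfl hzw
        · rfl
      exact ⟨fun _ => hE',
        fun h => absurd ((p01 _ _).mpr ⟨_, _, Bool.false_le _, rfl, rfl⟩) h⟩
    · intro x y z w hxy hzw hxz hyw hyz
      obtain ⟨b, c, hbc, rfl, rfl⟩ := (p10 _ _).mp hxz
      obtain ⟨b', c', hbc', rfl, rfl⟩ := (p10 _ _).mp hyw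
      have hb : ¬ b ≤ c' := fun h => hyz ((p10 _ _).mpr ⟨b, c', h, rfl, rfl⟩)
      obtain ⟨rfl, rfl⟩ : b = true ∧ c' = false := by
        revert hb
        cases b <;> cases c' <;> simp
      obtain rfl : b' = false := by
        cases b'
        · rfl
        · exact absurd rfl hzw
      obtain rfl : c = true := by
        cases c
        · exact absurd rfl hxy
        · rfl
      refine ⟨fun _ i hi j hj hij => ?_,
        fun h => absurd ((p10 _ _).mpr ⟨_, _, Bool.false_le _, rfl, rfl⟩) h⟩
      change L.top + 1 - t s' ≤ i → L.top + 1 - t s ≤ j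
      have := hE' (L.top - j) (Nat.sub_le _ _) (L.top - i) (Nat.sub_le _ _)
        (L.rel_symm i hi j hj hij)
      omega
  · have p01 : ∀ x z, (negRel s).HasPair ⟨0, Nat.zero_lt_two⟩ ⟨1, Nat.one_lt_two⟩ x z ↔
        ∃ b : Bool, x = (s, b) ∧ z = (s, !b) := by
      intro x z
      constructor
      · rintro ⟨r, ⟨b, h1, h2⟩, rfl, rfl⟩
        exact ⟨b, h1, h2⟩
      · rintro ⟨b, rfl, rfl⟩
        exact ⟨![(s, b), (s, !b)], ⟨b, rfl, rfl⟩, rfl, rfl⟩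
    have p10 : ∀ x z, (negRel s).HasPair ⟨1, Nat.one_lt_two⟩ ⟨0, Nat.zero_lt_two⟩ x z ↔
        ∃ b : Bool, x = (s, b) ∧ z = (s, !b) := by
      intro x z
      have hflip : (negRel s).HasPair ⟨1, Nat.one_lt_two⟩ ⟨0, Nat.zero_lt_two⟩ x z ↔
          (negRel s).HasPair ⟨0, Nat.zero_lt_two⟩ ⟨1, Nat.one_lt_two⟩ z x :=
        ⟨fun ⟨r, h, h1, h2⟩ => ⟨r, h, h2, h1⟩, fun ⟨r, h, h1, h2⟩ => ⟨r, h, h2, h1⟩⟩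
      rw [hflip, p01]
      constructor
      · rintro ⟨b, rfl, rfl⟩
        exact ⟨!b, rfl, by rw [Bool.not_not]⟩
      · rintro ⟨b, rfl, rfl⟩
        exact ⟨!b, rfl, by rw [Bool.not_not]⟩
    have hs' := hD s hs
    have main : ∀ (Q : Fin N × Bool → Fin N × Bool → Prop),
        (∀ x z, Q x z ↔ ∃ b : Bool, x = (s, b) ∧ z = (s, !b)) → ∀ x y z w, x ≠ y → z ≠ w →
        Q x z → Q y w → ¬ Q y z →
        (Q x w → ∀ i ≤ L.top, ∀ j ≤ L.top, L.rel i j →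
          sortThreshold L.top t x y ≤ i → sortThreshold L.top t z w ≤ j) ∧
        (¬ Q x w → sortThreshold L.top t x y = sortThreshold L.top t z w) := by
      intro Q hQ x y z w hxy hzw hxz hyw hyz
      rw [hQ] at hxz hyw ⊢
      obtain ⟨b, rfl, rfl⟩ := hxz
      obtain ⟨b', rfl, rfl⟩ := hyw
      obtain rfl : b' = !b := by
        cases b <;> cases b'
        · exact absurd rfl hxy
        · rfl
        · rfl
        · exact absurd rfl hxy
      refine ⟨?_, fun _ => ?_⟩
      · rintro ⟨c, h1, h2⟩
        rw [Prod.mk.injEq] at h1 h2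
        rw [← h1.2] at h2
        cases b <;> simp at h2
      · cases b
        · change t s = L.top + 1 - t s
          omega
        · change L.top + 1 - t s = t s
          omega
    exact forall_fin_two (forall_fin_two (diag _ _) (main _ p01))
      (forall_fin_two (main _ p10) (diag _ _))

theorem CoreName.exists_realization (c : CoreName) (hm : 1 ≤ c.level.top) {N : ℕ} (hN : 0 < N)
    (E : Fin N → Fin N → Prop) (D : Fin N → Prop) (t : Fin N → ℕ)
    (ht : ∀ s, 1 ≤ t s ∧ t s ≤ c.level.top)
    (hE : ∀ s s', E s s' → ∀ i ≤ c.level.top, ∀ j ≤ c.level.top, c.level.rel i j →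
      t s ≤ i → t s' ≤ j)
    (hD : ∀ s, D s → 2 * t s = c.level.top + 1)
    (hom : ∀ (M : Minion.{0}) (H : Fin N → BoolFunctional M), (∀ s s', E s s' → (H s).Tri (H s')) →
      (∀ s, D s → H s = (H s).dual) → M.HomLE c.minion) :
    ∃ (A : Type) (_ : Finite A) (_ : Nonempty A) (Ψ : Set (FinitaryRel A)),
      (∀ R ∈ Ψ, (R.arity : ℕ) ≤ 2 ∧ R.HasSmallProjections) ∧ (Pol Ψ).Equivalent c.minion := by
  have : Nonempty (Fin N × Bool) := ⟨(⟨0, hN⟩, false)⟩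
  exact ⟨Fin N × Bool, inferInstance, inferInstance, sortedRels E D, sortedRels_small,
    hom _ (sortFunctional E D) (fun _ _ h => sortFunctional_tri h)
      (fun _ h => sortFunctional_eq_dual h),
    c.homLE_level.trans (LevelStructure.homLE_Pol hm (isThreshold_sortThreshold hm ht)
      sortedRels_small (sortedRels_isCompatible ht hE hD))⟩

theorem BoolFunctional.isWalk_of_fin {M : Minion.{u}} {N n : ℕ} (hn : n < N)
    {H : Fin N → BoolFunctional M}
    (h : ∀ s s' : Fin N, (s : ℕ) + 1 = s' → (s' : ℕ) ≤ n → (H s).Tri (H s')) :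
    IsWalk (fun i => H ⟨min i (N - 1), by omega⟩) n := fun i hi =>
  h _ _ (by simp only; omega) (by simp only; omega)

theorem CoreName.exists_realization_minion (c : CoreName) :
    ∃ (A : Type) (_ : Finite A) (_ : Nonempty A) (Ψ : Set (FinitaryRel A)),
      (∀ R ∈ Ψ, (R.arity : ℕ) ≤ 2 ∧ R.HasSmallProjections) ∧ (Pol Ψ).Equivalent c.minion := by
  cases c with
  | T =>
    exact ⟨Unit, inferInstance, inferInstance, ∅, fun R hR => hR.elim,
      equivalent_T_of_subsingleton _⟩
  | A k hk =>
    refine exists_realization _ (by change 1 ≤ 2 * k; omega) (N := 2 * k - 1) (by omega)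
      (fun s s' => (s : ℕ) + 1 = s') (fun _ => False)
      -- A path of $2k-1$ sorts. The thresholds skip $k$: the step after the middle sort goes from
      -- $k+1$ to $k-1$, where the exceptional drop costs nothing.
      (fun s => if (s : ℕ) < k then 2 * k - s else 2 * k - 1 - s) (fun s => ?_)
      (fun s s' hss i hi j hj hij => ?_) (fun s hs => hs.elim) fun M H h1 h2 => ?_
    · change 1 ≤ _ ∧ _ ≤ 2 * k
      have := s.2
      split_ifs <;> omega
    · change i ≤ j + 1 ∨ (i = k + 1 ∧ j + 1 = k) at hij
      have := s'.2
      split_ifs <;> omega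
    · exact BoolFunctional.IsWalk.homLE_A (BoolFunctional.isWalk_of_fin (n := 2 * k - 2)
        (by omega) fun s s' hss _ => h1 s s' hss)
  | B k hk =>
    refine exists_realization _ (by change 1 ≤ 2 * k; omega) (N := 2 * k) (by omega)
      (fun s s' => (s : ℕ) + 1 = s') (fun _ => False)
      (fun s => 2 * k - s) (fun s => ?_)
      (fun s s' hss i hi j hj hij => ?_) (fun s hs => hs.elim) fun M H h1 h2 => ?_
    · change 1 ≤ _ ∧ _ ≤ 2 * k
      have := s.2
      omega
    · change i ≤ j + 1 at hij
      have := s'.2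
      omega
    · exact BoolFunctional.IsWalk.homLE_B (BoolFunctional.isWalk_of_fin (n := 2 * k - 1)
        (by omega) fun s s' hss _ => h1 s s' hss)
  | C k hk =>
    refine exists_realization _ (by change 1 ≤ 2 * k - 1; omega) (N := 2 * k - 1) (by omega)
      (fun s s' => (s : ℕ) + 1 = s' ∧ (s' : ℕ) ≤ 2 * k - 3) (fun s => (s : ℕ) = 2 * k - 2)
      -- The path has $2k-2$ sorts, and its thresholds jump from $k+1$ to $k-1$. The skipped value
      -- $k$ goes to the separate self-dual sort.
      (fun s => if (s : ℕ) + 1 < k then 2 * k - 1 - s else if (s : ℕ) = 2 * k - 2 then k else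
        2 * k - 2 - s) (fun s => ?_)
      (fun s s' hss i hi j hj hij => ?_) (fun s hs => ?_) fun M H h1 h2 => ?_
    · change 1 ≤ _ ∧ _ ≤ 2 * k - 1
      have := s.2
      split_ifs <;> omega
    · change i ≤ j + 1 ∨ (i = k ∧ j + 2 = k) ∨ (i = k + 1 ∧ j + 1 = k) at hij
      have := s'.2
      split_ifs <;> omega
    · change _ = 2 * k - 1 + 1
      rw [if_neg (by omega), if_pos hs]
      omega
    · exact BoolFunctional.IsWalk.homLE_C hk (BoolFunctional.isWalk_of_fin (n := 2 * k - 3)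
        (by omega) fun s s' hss hs' => h1 s s' ⟨hss, hs'⟩) (h2 ⟨2 * k - 2, by omega⟩ rfl)
  | D k hk =>
    refine exists_realization _ (by change 1 ≤ 2 * k - 1; omega) (N := 2 * k) (by omega)
      (fun s s' => (s : ℕ) + 1 = s' ∧ (s' : ℕ) ≤ 2 * k - 2) (fun s => (s : ℕ) = 2 * k - 1)
      -- The thresholds run through $2k-1,\dots,1$ on a path of $2k-1$ sorts; the last sort is
      -- isolated and self-dual.
      (fun s => if (s : ℕ) = 2 * k - 1 then k else 2 * k - 1 - s) (fun s => ?_)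
      (fun s s' hss i hi j hj hij => ?_) (fun s hs => ?_) fun M H h1 h2 => ?_
    · change 1 ≤ _ ∧ _ ≤ 2 * k - 1
      have := s.2
      split_ifs <;> omega
    · change i ≤ j + 1 at hij
      have := s'.2
      split_ifs <;> omega
    · change _ = 2 * k - 1 + 1
      rw [if_pos hs]
      omega
    · exact BoolFunctional.IsWalk.homLE_D (BoolFunctional.isWalk_of_fin (n := 2 * k - 2)
        (by omega) fun s s' hss hs' => h1 s s' ⟨hss, hs'⟩) (h2 ⟨2 * k - 1, by omega⟩ rfl)
  | BInf =>
    exact exists_realization _ (by decide) (N := 1) one_pos (fun _ _ => True) (fun _ => False)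
      (fun _ => 2) (fun _ => ⟨by decide, le_rfl⟩) (fun _ _ _ i _ j _ hij h => le_trans h hij)
      (fun _ h => h.elim) fun M H h1 _ => BoolFunctional.homLE_BInf (h1 0 0 trivial)
  | CInf =>
    refine exists_realization _ (by decide) (N := 2) two_pos (fun s s' => s = 0 ∧ s' = 0)
      (fun s => s = 1) (fun s => 3 - s) (fun s => ?_) (fun s s' hss i hi j hj hij => ?_)
      (fun s hs => ?_) fun M H h1 h2 =>
        BoolFunctional.homLE_CInf (h1 0 0 ⟨rfl, rfl⟩) (h2 1 rfl)
    · change 1 ≤ 3 - (s : ℕ) ∧ 3 - (s : ℕ) ≤ 3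
      omega
    · change i ≤ 3 at hi
      change i ≤ j ∨ (i = 2 ∧ j = 1) at hij
      rw [hss.1, hss.2]
      change 3 ≤ i → 3 ≤ j
      omega
    · rw [hs]
      rfl
  | DInf =>
    refine exists_realization _ (by decide) (N := 1) one_pos (fun _ _ => True) (fun _ => True)
      (fun _ => 1) (fun _ => ⟨le_rfl, le_rfl⟩) (fun _ _ _ i _ j _ hij h => le_trans h hij)
      (fun _ _ => rfl) fun M H h1 h2 => ?_
    have h3 := h1 0 0 trivial
    refine BoolFunctional.homLE_DInf (F := H 0) ?_ ?_
    · rwa [← h2 0 trivial]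
    · rwa [← h2 0 trivial]

theorem mainTheorem2 :
    (∀ c : CoreName, c.minion.IsCore) ∧
    (∀ (A : Type*) [Finite A] (Ψ : Set (FinitaryRel A)),
      (∀ R ∈ Ψ, (R.arity : ℕ) ≤ 2 ∧ R.HasSmallProjections) →
        ∃! c : CoreName, (Pol Ψ).Equivalent c.minion) ∧
    (∀ c : CoreName, ∃ (A : Type) (_ : Finite A) (_ : Nonempty A) (Ψ : Set (FinitaryRel A)),
      (∀ R ∈ Ψ, (R.arity : ℕ) ≤ 2 ∧ R.HasSmallProjections) ∧
        (Pol Ψ).Equivalent c.minion) := by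
  refine ⟨CoreName.isCore, fun A _ Ψ hΨ => ?_, CoreName.exists_realization_minion⟩
  obtain ⟨c, hc⟩ := exists_equivalent_minion Ψ hΨ
  exact ⟨c, hc, fun d hd => CoreName.eq_of_homLE (hd.2.trans hc.1) (hc.2.trans hd.1)⟩
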